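/- Let $B$ be a compact connected smooth manifold without boundary of dimension $2n$, let $\pi : M \to B$ be a smooth principal $\mathbb{S}^1$-bundle, so that $\dim M = 2n+1$, and let $\alpha$ be a connection form on $M$: an $\mathbb{S}^1$-invariant real-valued 1-form with $\alpha(X) = 1$, where $X$ generates the circle action. A contact form on $M$ is a smooth 1-form $\omega$ such that $\omega \wedge (d\omega)^n$ vanishes nowhere. Every invariant 1-form $\omega$ on $M$ can be written in a unique way as $\omega = \pi^*(\eta) + \pi^*(\varphi)\,\alpha$ with a smooth 1-form $\eta$ and a smooth function $\varphi$ on $B$; the singular set of $\omega$ is $\Sigma_\omega = \varphi^{-1}(0) \subseteq B$. Let $p \ge 0$, and let $\omega_1, \dots, \omega_{p+1}$ be 1-forms on $M$ that generate an invariant contact $p$-sphere, that is, every element of $$\mathcal{S} = \Big\{ \sum_{i=1}^{p+1} \lambda_i\,\omega_i \;\Big|\; \sum_{i=1}^{p+1} \lambda_i^2 = 1 \Big\}$$ is an invariant contact form (for $p = 1$, $\mathcal{S}$ is called an invariant contact circle). Then: i) For every $\omega \in \mathcal{S}$, the singular set $\Sigma_\omega$ is a smooth embedded submanifold of $B$ of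 codimension 1 (possibly empty if $p=0$). ii) If $p \ge 1$ (in particular, for a contact circle), each point of $B$ lies on $\Sigma_\omega$ for some $\omega \in \mathcal{S}$. iii) For all $\omega, \omega' \in \mathcal{S}$, the sets $\Sigma_\omega$ and $\Sigma_{\omega'}$ are isotopic in $B$: there is a smooth family $(F_t)_{t \in [0,1]}$ of diffeomorphisms of $B$ with $F_0 = \mathrm{id}$ and $F_1(\Sigma_\omega) = \Sigma_{\omega'}$. iv) If $p \ge 1$, then $\Sigma_\omega \neq \emptyset$ for every $\omega \in \mathcal{S}$. v) If $\omega, \omega' \in \mathcal{S}$ and $\omega' \ne \pm\omega$, then $\Sigma_\omega$ and $\Sigma_{\omega'}$ intersect transversally: $T_x\Sigma_\omega + T_x\Sigma_{\omega'} = T_xB$ for every $x \in \Sigma_\omega \cap \Sigma_{\omega'}$. -/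

import Mathlib

open scoped Manifold ContDiff Bundle

noncomputable section

namespace ContactSphere

/-! ### Exterior algebra on a single vector space -/

/-- The exterior product `a ∧ b` of two alternating forms on a real vector space: the sum over
`(k, l)`-shuffles of the signed products of values. -/
def wedge {V : Type*} [AddCommGroup V] [Module ℝ V] {k l : ℕ}
    (a : V [⋀^Fin k]→ₗ[ℝ] ℝ) (b : V [⋀^Fin l]→ₗ[ℝ] ℝ) : V [⋀^Fin (k + l)]→ₗ[ℝ] ℝ :=
  ((LinearMap.mul' ℝ ℝ).compAlternatingMap (a.domCoprod b)).domDomCongr finSumFinEquiv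

/-- The exterior power `b ∧ ⋯ ∧ b` (`n` factors) of an alternating 2-form. -/
def wedgePow {V : Type*} [AddCommGroup V] [Module ℝ V] (b : V [⋀^Fin 2]→ₗ[ℝ] ℝ) :
    (n : ℕ) → V [⋀^Fin (2 * n)]→ₗ[ℝ] ℝ
  | 0 => AlternatingMap.constOfIsEmpty ℝ V (Fin 0) (1 : ℝ)
  | n + 1 => wedge (wedgePow b n) b

/-! ### Differential 1-forms on a manifold without boundary -/

/-- Smooth real-valued 1-forms on the `d`-dimensional manifold `X`: smooth sections of the
cotangent bundle. -/
abbrev OneForm (d : ℕ) (X : Type*) [TopologicalSpace X]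
    [ChartedSpace (EuclideanSpace ℝ (Fin d)) X] [IsManifold (𝓡 d) ∞ X] :=
  ContMDiffSection (𝓡 d) (EuclideanSpace ℝ (Fin d) →L[ℝ] ℝ) ∞
    (fun x : X => TangentSpace (𝓡 d) x →L[ℝ] ℝ)

section Forms

variable {d : ℕ} {X : Type*} [TopologicalSpace X]
  [ChartedSpace (EuclideanSpace ℝ (Fin d)) X] [IsManifold (𝓡 d) ∞ X]

/-- The coordinate expression of a 1-form in the preferred chart at `x`, that is, its pullback
under the inverse of that chart, as a 1-form on Euclidean space. -/
def OneForm.inChart (w : OneForm d X) (x : X) (y : EuclideanSpace ℝ (Fin d)) :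
    EuclideanSpace ℝ (Fin d) [⋀^Fin 1]→L[ℝ] ℝ :=
  ContinuousAlternatingMap.ofSubsingleton ℝ (EuclideanSpace ℝ (Fin d)) ℝ (0 : Fin 1)
    ((w ((extChartAt (𝓡 d) x).symm y)).comp
      (mfderiv 𝓘(ℝ, EuclideanSpace ℝ (Fin d)) (𝓡 d) (extChartAt (𝓡 d) x).symm y))

/-- The exterior derivative `dw` at `x`: the exterior derivative of the coordinate expression of
`w` in the chart at `x`, pulled back by the differential of that chart. -/
def OneForm.extDerivAt (w : OneForm d X) (x : X) : TangentSpace (𝓡 d) x [⋀^Fin 2]→ₗ[ℝ] ℝ :=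
  (extDeriv (w.inChart x) (extChartAt (𝓡 d) x x)).toAlternatingMap.compLinearMap
    (mfderiv (𝓡 d) 𝓘(ℝ, EuclideanSpace ℝ (Fin d)) (extChartAt (𝓡 d) x) x).toLinearMap

/-- The value of `w` at `x`, as an alternating form of degree 1 on the tangent space. -/
def OneForm.alternatingAt (w : OneForm d X) (x : X) :
    TangentSpace (𝓡 d) x [⋀^Fin 1]→ₗ[ℝ] ℝ :=
  AlternatingMap.ofSubsingleton ℝ (TangentSpace (𝓡 d) x) ℝ (0 : Fin 1) (w x).toLinearMap

end Forms

/-- A 1-form `w` on a `(2n+1)`-dimensional manifold is a contact form if the form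
`w ∧ (dw)ⁿ` of top degree vanishes nowhere. -/
def IsContactForm {n : ℕ} {M : Type*} [TopologicalSpace M]
    [ChartedSpace (EuclideanSpace ℝ (Fin (2 * n + 1))) M] [IsManifold (𝓡 (2 * n + 1)) ∞ M]
    (w : OneForm (2 * n + 1) M) : Prop :=
  ∀ x : M, wedge (w.alternatingAt x) (wedgePow (w.extDerivAt x) n) ≠ 0

/-! ### Principal circle bundles, connection forms, invariant forms -/

/-- `pr : M → B` is a smooth principal circle bundle for the given action of the circle on `M`:
the action and the projection are smooth, the action preserves the fibres, and
over a neighbourhood `U` of every point of `B` there is an equivariant diffeomorphism `pr⁻¹(U) ≃ U × 𝕊¹` over `U`. -/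
structure IsPrincipalCircleBundle {d e : ℕ} {B M : Type*} [TopologicalSpace B]
    [ChartedSpace (EuclideanSpace ℝ (Fin d)) B] [TopologicalSpace M]
    [ChartedSpace (EuclideanSpace ℝ (Fin e)) M] [MulAction Circle M] (pr : M → B) : Prop where
  contMDiff_smul : ContMDiff ((𝓡 1).prod (𝓡 e)) (𝓡 e) ∞ (fun q : Circle × M => q.1 • q.2)
  contMDiff_proj : ContMDiff (𝓡 e) (𝓡 d) ∞ pr
  proj_smul : ∀ (z : Circle) (x : M), pr (z • x) = pr x
  exists_trivialization : ∀ b : B, ∃ U : Set B, IsOpen U ∧ b ∈ U ∧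
    ∃ τ : OpenPartialHomeomorph M (B × Circle),
      τ.source = pr ⁻¹' U ∧ τ.target = U ×ˢ Set.univ ∧
      ContMDiffOn (𝓡 e) ((𝓡 d).prod (𝓡 1)) ∞ τ τ.source ∧
      ContMDiffOn ((𝓡 d).prod (𝓡 1)) (𝓡 e) ∞ τ.symm τ.target ∧
      (∀ x ∈ τ.source, (τ x).1 = pr x) ∧
      ∀ x ∈ τ.source, ∀ z : Circle, τ (z • x) = (pr x, z * (τ x).2)

section Invariant

variable {d : ℕ} {M : Type*} [TopologicalSpace M]
  [ChartedSpace (EuclideanSpace ℝ (Fin d)) M] [IsManifold (𝓡 d) ∞ M] [MulAction Circle M]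

/-- A 1-form is invariant if its pullback by every element of the circle is the form itself. -/
def InvariantForm (w : OneForm d M) : Prop :=
  ∀ (z : Circle) (x : M),
    (w (z • x)).comp (mfderiv (𝓡 d) (𝓡 d) (fun y : M => z • y) x) = w x

/-- A connection form: an invariant 1-form that takes the value 1 on the generator
`d/dt (e^{it} • x)` at `t = 0` of the circle action. -/
def IsConnectionForm (α : OneForm d M) : Prop :=
  InvariantForm α ∧ ∀ x : M,
    α (Circle.exp 0 • x) (mfderiv 𝓘(ℝ, ℝ) (𝓡 d) (fun t : ℝ => Circle.exp t • x) 0 (1 : ℝ)) = 1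

end Invariant

/-- The equality `w = pr^*(η) + pr^*(φ) α` of 1-forms on `M`. -/
def Decomposes {d e : ℕ} {B M : Type*} [TopologicalSpace B]
    [ChartedSpace (EuclideanSpace ℝ (Fin d)) B] [IsManifold (𝓡 d) ∞ B] [TopologicalSpace M]
    [ChartedSpace (EuclideanSpace ℝ (Fin e)) M] [IsManifold (𝓡 e) ∞ M]
    (pr : M → B) (α w : OneForm e M) (η : OneForm d B) (φ : B → ℝ) : Prop :=
  ∀ x : M, w x = (η (pr x)).comp (mfderiv (𝓡 e) (𝓡 d) pr x) + φ (pr x) • α x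

/-- The singular set `φ⁻¹(0) ⊆ B` of an invariant form `w = pr^*(η) + pr^*(φ) α`, where `η` is a
smooth 1-form and `φ` a smooth function on `B`. Every invariant `w` has exactly one such
decomposition when `α` is a connection form on a principal circle bundle. -/
def singularSet {d e : ℕ} {B M : Type*} [TopologicalSpace B]
    [ChartedSpace (EuclideanSpace ℝ (Fin d)) B] [IsManifold (𝓡 d) ∞ B] [TopologicalSpace M]
    [ChartedSpace (EuclideanSpace ℝ (Fin e)) M] [IsManifold (𝓡 e) ∞ M]
    (pr : M → B) (α w : OneForm e M) : Set B :=
  {b | ∃ (η : OneForm d B) (φ : B → ℝ),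
    ContMDiff (𝓡 d) 𝓘(ℝ, ℝ) ∞ φ ∧ Decomposes pr α w η φ ∧ φ b = 0}

/-- The family of all normalized linear combinations of `p + 1` given 1-forms. -/
def sphereFamily {p d : ℕ} {M : Type*} [TopologicalSpace M]
    [ChartedSpace (EuclideanSpace ℝ (Fin d)) M] [IsManifold (𝓡 d) ∞ M]
    (w : Fin (p + 1) → OneForm d M) : Set (OneForm d M) :=
  {θ | ∃ c : Fin (p + 1) → ℝ, ∑ i, c i ^ 2 = 1 ∧ θ = ∑ i, c i • w i}

/-- The forms `w 0, …, w p` generate an invariant contact `p`-sphere: all elements of the family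
generated by them are contact forms and are invariant under the circle action. -/
def IsInvariantContactSphere {p n : ℕ} {M : Type*} [TopologicalSpace M]
    [ChartedSpace (EuclideanSpace ℝ (Fin (2 * n + 1))) M] [IsManifold (𝓡 (2 * n + 1)) ∞ M]
    [MulAction Circle M] (w : Fin (p + 1) → OneForm (2 * n + 1) M) : Prop :=
  ∀ θ ∈ sphereFamily w, IsContactForm θ ∧ InvariantForm θ

/-! ### Submanifolds, isotopies, transversality -/

section Submanifolds

variable {d : ℕ} {B : Type*} [TopologicalSpace B] [ChartedSpace (EuclideanSpace ℝ (Fin d)) B]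

/-- `S` is a smooth embedded submanifold of codimension `k`: around each point of `S` there is a
smooth chart of `B` in which `S` is given by a linear subspace of codimension `k`. -/
def IsSubmanifold (k : ℕ) (S : Set B) : Prop :=
  ∀ x ∈ S, ∃ e ∈ IsManifold.maximalAtlas (𝓡 d) ∞ B, x ∈ e.source ∧
    ∃ F : Submodule ℝ (EuclideanSpace ℝ (Fin d)), Module.finrank ℝ F + k = d ∧
      ∀ y ∈ e.source, y ∈ S ↔ e y ∈ F

/-- The tangent space at `x` of a submanifold `S`, as a subspace of the tangent space of `B`: the
span of the velocities at time 0 of the smooth curves in `S` that pass through `x` at time 0. -/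
def tangentSpaceOf (S : Set B) (x : B) : Submodule ℝ (TangentSpace (𝓡 d) x) :=
  Submodule.span ℝ {v : TangentSpace (𝓡 d) x | ∃ (γ : ℝ → B) (ε : ℝ) (h : γ 0 = x), 0 < ε ∧
    ContMDiffOn 𝓘(ℝ, ℝ) (𝓡 d) ∞ γ (Set.Ioo (-ε) ε) ∧ (∀ t ∈ Set.Ioo (-ε) ε, γ t ∈ S) ∧
    (h ▸ (mfderiv 𝓘(ℝ, ℝ) (𝓡 d) γ 0 (1 : ℝ) : TangentSpace (𝓡 d) (γ 0))) = v}

/-- Two submanifolds intersect transversally: at each common point, their tangent spaces together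
span the tangent space of `B`. -/
def IntersectTransversally (S T : Set B) : Prop :=
  ∀ x ∈ S ∩ T, tangentSpaceOf (d := d) S x ⊔ tangentSpaceOf (d := d) T x = ⊤

/-- `S` and `T` are (ambient) isotopic in `B`: there is a family of diffeomorphisms of `B`,
depending smoothly on the time `t ∈ [0, 1]`, that starts at the identity and ends at a
diffeomorphism which maps `S` onto `T`. -/
def AreIsotopic (S T : Set B) : Prop :=
  ∃ F : ℝ → Diffeomorph (𝓡 d) (𝓡 d) B B ∞,
    ContMDiffOn (𝓘(ℝ, ℝ).prod (𝓡 d)) (𝓡 d) ∞ (fun q : ℝ × B => F q.1 q.2)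
      (Set.Icc (0 : ℝ) 1 ×ˢ (Set.univ : Set B)) ∧
    (∀ x, F 0 x = x) ∧ F 1 '' S = T

end Submanifolds

end ContactSphere

end

/-!
The vertical coefficient of an invariant form `w` is the function `φ` on the base `B` whose value
at `pr x` is `w (X x)`, where `X` generates the circle action. It is linear in `w`, and since
`α X = 1` and `X` spans the kernel of the differential of `pr`, every invariant form decomposes as
`pr^*(η) + pr^*(φ) α` with this `φ` and no other (`IsPrincipalCircleBundle.exists_decomposes`,
`Decomposes.eq_apply_verticalVector`). The singular set of `w` is therefore the zero set of `φ`
(`singularSet_eq`).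

Contact forms enter only through the following fact (`IsContactForm.differentialAt_ne_zero`): the
vertical coefficient of a contact form has no critical zero. At a critical zero, both `w` and `dw`
would be pulled back from the base, so that the kernel of the differential of `pr` would lie in
the kernels of `w` and of `dw`, hence in the kernel of the form `w ∧ (dw)ⁿ` of top degree. For the
generators `w i` of a contact sphere, with vertical coefficients `φ i`, this says that a
non-trivial combination `∑ i, c i * φ i` never vanishes together with its differential
(`IsInvariantContactSphere.isRegularSystem`). The rest concerns such systems of functions on a
compact manifold.

* The zero set of a combination is a submanifold of codimension 1 (`isSubmanifold_zeroSet`), and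
  two independent combinations have independent differentials at their common zeros, so that
  their zero sets are transverse (`intersectTransversally_zeroSets`).
* If there are at least two functions, then for a given point `b` the linear functional
  `c ↦ ∑ i, c i * φ i b` has a zero on the unit sphere.
* For independent combinations `f` and `g`, there is a vector field that acts on `(f, g)` by the
  infinitesimal rotation `(-g, f)`, up to a dilation: at the common zeros, `(f, g)` is a
  submersion, and elsewhere the polar angle of `(f, g)` has no critical point; the local solutions
  are glued by a partition of unity (`exists_vectorField_rotatesPencil`). The flow of this field
  carries the zero set of `f` to that of `cos β * f + sin β * g` in time `β`
  (`areIsotopic_zeroSets_of_isRegularPencil`). Together with the previous point, the existence of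
  an isotopy shows that no singular set is empty.

The smooth flow of a vector field on a compact manifold (`exists_contMDiff_flow`) is obtained from
smooth dependence on initial values, for which the inverse function theorem is applied to the
integral equation `u = x + τ ∫ f(u)` in a space of continuous functions
(`exists_contDiffOn_solution`).
-/

noncomputable section

namespace ContactSphere

open Set Filter Topology

/-! ### Smooth dependence of solutions of ordinary differential equations -/

/-- The inverse function theorem for maps that are smooth on an open set: near a point with
invertible differential, the map is a diffeomorphism between open sets. -/
theorem exists_openPartialHomeomorph_contDiffOn_symm {E F : Type*} [NormedAddCommGroup E]
    [NormedSpace ℝ E] [CompleteSpace E] [NormedAddCommGroup F] [NormedSpace ℝ F]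
    {f : E → F} {s : Set E} (hs : IsOpen s) (hf : ContDiffOn ℝ ∞ f s) {a : E} (ha : a ∈ s)
    (f' : E ≃L[ℝ] F) (hf' : HasFDerivAt f (f' : E →L[ℝ] F) a) :
    ∃ e : OpenPartialHomeomorph E F, ⇑e = f ∧ a ∈ e.source ∧ e.source ⊆ s ∧
      ContDiffOn ℝ ∞ e.symm e.target := by
  have hne : (∞ : WithTop ℕ∞) ≠ 0 := by simp
  have hfa : ContDiffAt ℝ ∞ f a := hf.contDiffAt (hs.mem_nhds ha)
  have hcont : ContinuousOn (fderiv ℝ f) s :=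
    hf.continuousOn_fderiv_of_isOpen hs (by simp)
  -- shrink to the open set of points with invertible differential, where the inverse is smooth
  set t : Set E := s ∩ fderiv ℝ f ⁻¹' range ((↑) : (E ≃L[ℝ] F) → E →L[ℝ] F) with ht
  have hto : IsOpen t := hcont.isOpen_inter_preimage hs ContinuousLinearEquiv.isOpen
  have hat : a ∈ t := ⟨ha, f', hf'.fderiv.symm⟩
  set e₀ := hfa.toOpenPartialHomeomorph f hf' hne
  have he₀ : ⇑e₀ = f := rfl
  refine ⟨e₀.restrOpen t hto, rfl, ?_, ?_, ?_⟩
  · exact ⟨hfa.mem_toOpenPartialHomeomorph_source hf' hne, hat⟩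
  · exact fun x hx => hx.2.1
  · intro y hy
    have hy' : (e₀.restrOpen t hto).symm y ∈ (e₀.restrOpen t hto).source :=
      (e₀.restrOpen t hto).map_target hy
    obtain ⟨g, hg⟩ := hy'.2.2
    have hc : ContDiffAt ℝ ∞ f ((e₀.restrOpen t hto).symm y) :=
      hf.contDiffAt (hs.mem_nhds hy'.2.1)
    refine ((e₀.restrOpen t hto).contDiffAt_symm hy (f₀' := g) ?_ hc).contDiffWithinAt
    rw [hg]
    exact (hc.differentiableAt hne).hasFDerivAt

section Superposition

variable {K : Type*} [TopologicalSpace K] [CompactSpace K]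
  {E F G : Type*} [NormedAddCommGroup E] [NormedSpace ℝ E] [NormedAddCommGroup F]
  [NormedSpace ℝ F] [NormedAddCommGroup G] [NormedSpace ℝ G]

/-- Pointwise application of a continuous bilinear map, as a continuous bilinear map between
spaces of continuous functions. -/
def pointwiseApply (b : G →L[ℝ] E →L[ℝ] F) : C(K, G) →L[ℝ] C(K, E) →L[ℝ] C(K, F) :=
  LinearMap.mkContinuous₂
    (LinearMap.mk₂ ℝ (fun (A : C(K, G)) (h : C(K, E)) =>
        (⟨fun t => b (A t) (h t), by fun_prop⟩ : C(K, F)))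
      (fun _ _ _ => by ext; simp) (fun _ _ _ => by ext; simp)
      (fun _ _ _ => by ext; simp) (fun _ _ _ => by ext; simp)) ‖b‖ (by
    intro A h
    rw [ContinuousMap.norm_le _ (by positivity)]
    intro t
    refine (b.le_opNorm₂ _ _).trans ?_
    gcongr
    exacts [A.norm_coe_le_norm t, h.norm_coe_le_norm t])

/-- The derivative of the superposition operator `v ↦ f ∘ v`. The derivative of `f` is factored
as `x ↦ b (f' x)` through an arbitrary normed space. -/
theorem hasFDerivAt_superposition {f : E → F} {f' : E → G} {b : G →L[ℝ] E →L[ℝ] F}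
    (hf : Continuous f) (hf' : Continuous f') (hff' : ∀ x, HasFDerivAt f (b (f' x)) x)
    (u : C(K, E)) :
    HasFDerivAt (fun v : C(K, E) => (⟨f, hf⟩ : C(E, F)).comp v)
      (pointwiseApply b ((⟨f', hf'⟩ : C(E, G)).comp u)) u := by
  rw [hasFDerivAt_iff_isLittleO_nhds_zero, Asymptotics.isLittleO_iff]
  intro c hc
  -- continuity of `v ↦ f' ∘ v` at `u` gives the uniform bound needed in the mean value inequality
  have hcont : Continuous (fun v : C(K, E) => (⟨f', hf'⟩ : C(E, G)).comp v) :=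
    ContinuousMap.continuous_postcomp _
  have hb : 0 < ‖b‖ + 1 := by positivity
  obtain ⟨δ, hδ, hball⟩ := Metric.continuousAt_iff.1 (hcont.continuousAt (x := u))
    (c / (‖b‖ + 1)) (by positivity)
  filter_upwards [Metric.ball_mem_nhds (0 : C(K, E)) hδ] with h hh
  rw [mem_ball_zero_iff] at hh
  rw [ContinuousMap.norm_le _ (by positivity)]
  intro t
  have key : ∀ x ∈ segment ℝ (u t) (u t + h t), ‖b (f' x) - b (f' (u t))‖ ≤ c := by
    rintro x hx
    rw [segment_eq_image'] at hx
    obtain ⟨s, hs, rfl⟩ := hx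
    have h1 : dist (u + s • h) u < δ := by
      rw [dist_eq_norm, add_sub_cancel_left, norm_smul, Real.norm_eq_abs, abs_of_nonneg hs.1]
      nlinarith [hs.2, norm_nonneg h]
    have h2 := (ContinuousMap.dist_apply_le_dist t).trans (hball h1).le
    rw [← map_sub]
    refine (b.le_opNorm _).trans ?_
    have h3 : ‖f' (u t + s • h t) - f' (u t)‖ ≤ c / (‖b‖ + 1) := by
      simpa [dist_eq_norm] using h2
    rw [add_sub_cancel_left]
    calc ‖b‖ * ‖f' (u t + s • h t) - f' (u t)‖
        ≤ (‖b‖ + 1) * (c / (‖b‖ + 1)) := by gcongr; linarith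
      _ = c := by field_simp
  have := (convex_segment (u t) (u t + h t)).norm_image_sub_le_of_norm_hasFDerivWithin_le'
    (f := f) (f' := fun x => b (f' x)) (φ := b (f' (u t))) (C := c)
    (fun x _ => (hff' x).hasFDerivWithinAt) key (left_mem_segment ℝ _ _)
    (right_mem_segment ℝ _ _)
  simp only [add_sub_cancel_left] at this
  exact this.trans (mul_le_mul_of_nonneg_left (h.norm_coe_le_norm t) hc.le)

theorem contDiff_succ_superposition {f : E → F} {f' : E → G} {b : G →L[ℝ] E →L[ℝ] F} {n : ℕ}
    (hf : Continuous f) (hf' : Continuous f') (hff' : ∀ x, HasFDerivAt f (b (f' x)) x)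
    (h : ContDiff ℝ n (fun v : C(K, E) => (⟨f', hf'⟩ : C(E, G)).comp v)) :
    ContDiff ℝ (n + 1 : ℕ) (fun v : C(K, E) => (⟨f, hf⟩ : C(E, F)).comp v) := by
  rw [show ((n + 1 : ℕ) : WithTop ℕ∞) = (n : WithTop ℕ∞) + 1 by push_cast; rfl,
    contDiff_succ_iff_hasFDerivAt]
  exact ⟨_, (pointwiseApply (K := K) b).contDiff.comp h,
    fun u => hasFDerivAt_superposition hf hf' hff' u⟩

end Superposition

/-- Composition on the left with a smooth map is a smooth operation on continuous functions. The
derivative is a superposition operator again, composed with a continuous linear map. -/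
theorem contDiff_nat_superposition.{u} {K : Type*} [TopologicalSpace K] [CompactSpace K]
    {E : Type u} [NormedAddCommGroup E] [NormedSpace ℝ E] (n : ℕ) :
    ∀ {F : Type u} [NormedAddCommGroup F] [NormedSpace ℝ F] {f : E → F} (hf : ContDiff ℝ ∞ f),
      ContDiff ℝ n (fun v : C(K, E) => (⟨f, hf.continuous⟩ : C(E, F)).comp v) := by
  induction n with
  | zero =>
    intro F _ _ f hf
    exact contDiff_zero.2 (ContinuousMap.continuous_postcomp _)
  | succ n ih =>
    intro F _ _ f hf
    have hd : Differentiable ℝ f := hf.differentiable (by simp)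
    have hf' : ContDiff ℝ ∞ (fderiv ℝ f) := hf.fderiv_right (by simp)
    exact contDiff_succ_superposition (b := ContinuousLinearMap.id ℝ (E →L[ℝ] F)) hf.continuous
      hf'.continuous (fun x => (hd x).hasFDerivAt) (ih hf')

theorem contDiff_superposition.{u} {K : Type*} [TopologicalSpace K] [CompactSpace K]
    {E : Type u} [NormedAddCommGroup E] [NormedSpace ℝ E] {F : Type u} [NormedAddCommGroup F]
    [NormedSpace ℝ F] {f : E → F} (hf : ContDiff ℝ ∞ f) :
    ContDiff ℝ ∞ (fun v : C(K, E) => (⟨f, hf.continuous⟩ : C(E, F)).comp v) :=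
  contDiff_infty.2 fun n => contDiff_nat_superposition n hf

section LocalFlow

variable {E : Type*} [NormedAddCommGroup E] [NormedSpace ℝ E]

/-- The operator `u ↦ (t ↦ ∫ s in 0..t, u s)` on continuous functions on `[-1, 1]`. -/
def primitive [CompleteSpace E] : C(Icc (-1 : ℝ) 1, E) →L[ℝ] C(Icc (-1 : ℝ) 1, E) :=
  LinearMap.mkContinuous
    { toFun := fun u => ⟨fun t => ∫ s in (0 : ℝ)..t, IccExtend (neg_le_self zero_le_one) u s,
        (intervalIntegral.continuous_primitive
          (fun a b => (u.continuous.Icc_extend').intervalIntegrable a b) 0).comp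
          continuous_subtype_val⟩
      map_add' := fun u v => by
        ext t
        exact intervalIntegral.integral_add (u.continuous.Icc_extend'.intervalIntegrable _ _)
          (v.continuous.Icc_extend'.intervalIntegrable _ _)
      map_smul' := fun c u => by
        ext t
        exact intervalIntegral.integral_smul c _ } 1 (by
    intro u
    rw [ContinuousMap.norm_le _ (by positivity)]
    intro t
    refine (intervalIntegral.norm_integral_le_of_norm_le_const (C := ‖u‖)
      fun s _ => u.norm_coe_le_norm (projIcc _ _ _ s)).trans ?_
    rw [mul_comm]
    gcongr
    rw [sub_zero, abs_le]
    exact t.2)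

theorem primitive_apply [CompleteSpace E] (u : C(Icc (-1 : ℝ) 1, E)) (t : Icc (-1 : ℝ) 1) :
    primitive u t = ∫ s in (0 : ℝ)..t, IccExtend (neg_le_self zero_le_one) u s := rfl

/-- Constant functions, as a continuous linear map. -/
def constL (K : Type*) [TopologicalSpace K] [CompactSpace K] : E →L[ℝ] C(K, E) :=
  LinearMap.mkContinuous
    { toFun := fun x => ContinuousMap.const K x
      map_add' := fun _ _ => rfl
      map_smul' := fun _ _ => rfl } 1 (by
    intro x
    rw [ContinuousMap.norm_le _ (by positivity)]
    intro t
    exact (one_mul ‖x‖).ge)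

@[simp]
theorem constL_apply (K : Type*) [TopologicalSpace K] [CompactSpace K] (x : E) (t : K) :
    constL K x t = x := rfl

/-- Smooth dependence of the solutions of an autonomous differential equation on the initial value
and on a rescaling of time. The integral equation `u = x + τ ∫ f(u)` is solved by the inverse
function theorem in the space of continuous functions; at `τ = 0` the linearized equation is
trivially solvable. -/
theorem exists_contDiffOn_solution [CompleteSpace E] {f : E → E} (hf : ContDiff ℝ ∞ f) (x₀ : E) :
    ∃ (s : Set (ℝ × E)) (U : ℝ × E → C(Icc (-1 : ℝ) 1, E)), IsOpen s ∧ ((0 : ℝ), x₀) ∈ s ∧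
      ContDiffOn ℝ ∞ U s ∧ U (0, x₀) = constL _ x₀ ∧
      ∀ q ∈ s, U q = constL _ q.2
        + q.1 • primitive ((⟨f, hf.continuous⟩ : C(E, E)).comp (U q)) := by
  set C := C(Icc (-1 : ℝ) 1, E)
  set N : C → C := fun v => (⟨f, hf.continuous⟩ : C(E, E)).comp v with hN
  have hNs : ContDiff ℝ ∞ N := contDiff_superposition hf
  -- keeping `(τ, x)` as first component, the integral equation reads `G (τ, x, u) = (τ, x, 0)`
  set G : (ℝ × E) × C → (ℝ × E) × C :=
    fun q => (q.1, q.2 - constL _ q.1.2 - q.1.1 • primitive (N q.2)) with hG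
  have hGs : ContDiff ℝ ∞ G := by
    refine contDiff_fst.prodMk ((contDiff_snd.sub ?_).sub ?_)
    · exact (constL (E := E) (Icc (-1 : ℝ) 1)).contDiff.comp (contDiff_snd.comp contDiff_fst)
    · exact (contDiff_fst.comp contDiff_fst).smul
        (primitive.contDiff.comp (hNs.comp contDiff_snd))
  set a : (ℝ × E) × C := ((0, x₀), constL _ x₀) with ha
  set w : C := primitive (N (constL _ x₀)) with hw
  -- the differential of `G` at `a` is `(τ, x, u) ↦ (τ, x, u - L (τ, x))`
  set L : (ℝ × E) →L[ℝ] C := (constL _).comp (ContinuousLinearMap.snd ℝ ℝ E)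
    + (ContinuousLinearMap.fst ℝ ℝ E).smulRight w with hL
  set P := ContinuousLinearMap.fst ℝ (ℝ × E) C
  set Q := ContinuousLinearMap.snd ℝ (ℝ × E) C
  set D : ((ℝ × E) × C) ≃L[ℝ] ((ℝ × E) × C) :=
    ContinuousLinearEquiv.equivOfInverse (P.prod (Q - L.comp P)) (P.prod (Q + L.comp P))
      (fun q => by ext <;> simp [P, Q]) (fun q => by ext <;> simp [P, Q]) with hD
  have hGa : HasFDerivAt G (D : ((ℝ × E) × C) →L[ℝ] ((ℝ × E) × C)) a := by
    have h1 : HasFDerivAt (fun q : (ℝ × E) × C => q.1.1 • primitive (N q.2))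
        (((ContinuousLinearMap.fst ℝ ℝ E).comp P).smulRight w) a := by
      have hA : HasFDerivAt (fun q : (ℝ × E) × C => q.1.1)
        ((ContinuousLinearMap.fst ℝ ℝ E).comp P) a :=
        ((ContinuousLinearMap.fst ℝ ℝ E).comp P).hasFDerivAt
      have hB : DifferentiableAt ℝ (fun q : (ℝ × E) × C => primitive (N q.2)) a :=
        ((primitive (E := E)).contDiff.comp (hNs.comp contDiff_snd)).differentiable (by simp) a
      have := hA.smul hB.hasFDerivAt
      convert! this using 1
      ext <;> simp [a, w, P]
    have h2 : HasFDerivAt (fun q : (ℝ × E) × C => q.2 - constL (Icc (-1 : ℝ) 1) q.1.2)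
        (Q - ((constL _).comp (ContinuousLinearMap.snd ℝ ℝ E)).comp P) a :=
      ContinuousLinearMap.hasFDerivAt
        (Q - ((constL _).comp (ContinuousLinearMap.snd ℝ ℝ E)).comp P)
    have h3 := (ContinuousLinearMap.hasFDerivAt (x := a) P).prodMk (h2.sub h1)
    convert! h3 using 1
    ext q <;> simp [D, P, Q, L]
  obtain ⟨e, he, hae, -, hes⟩ := exists_openPartialHomeomorph_contDiffOn_symm isOpen_univ
    hGs.contDiffOn (mem_univ a) D hGa
  have hGa0 : G a = ((0, x₀), 0) := by simp [G, a]
  have hmem : ((0, x₀), (0 : C)) ∈ e.target := by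
    rw [← hGa0, ← he]; exact e.map_source hae
  have hfst : ∀ q ∈ e.target, (e.symm q).1 = q.1 := fun q hq => by
    have h : G (e.symm q) = q := by rw [← he]; exact e.right_inv hq
    exact (congrArg Prod.fst h : (G (e.symm q)).1 = q.1)
  refine ⟨(fun q : ℝ × E => (q, (0 : C))) ⁻¹' e.target, fun q => (e.symm (q, 0)).2, ?_, hmem, ?_,
    ?_, ?_⟩
  · exact e.open_target.preimage (by fun_prop)
  · exact contDiff_snd.comp_contDiffOn (hes.comp
      (contDiff_id.prodMk contDiff_const).contDiffOn fun q hq => hq)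
  · have : e.symm ((0, x₀), 0) = a := by
      rw [← hGa0, ← he]; exact e.left_inv hae
    simp [this, a]
  · intro q hq
    have h1 : G (e.symm (q, 0)) = (q, 0) := by rw [← he]; exact e.right_inv hq
    have h2 := hfst _ hq
    have h3 := congrArg Prod.snd h1
    simp only [hG] at h3
    rw [h2] at h3
    rw [sub_sub, sub_eq_zero] at h3
    exact h3

/-- A continuous solution of the integral equation solves the differential equation. -/
theorem hasDerivAt_of_eq_const_add_primitive [CompleteSpace E] {f : E → E} (hf : Continuous f)
    {u : C(Icc (-1 : ℝ) 1, E)} {x : E} {τ : ℝ}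
    (hu : u = constL _ x + τ • primitive ((⟨f, hf⟩ : C(E, E)).comp u)) {t : ℝ}
    (ht : t ∈ Ioo (-1 : ℝ) 1) :
    HasDerivAt (IccExtend (neg_le_self zero_le_one) u)
      (τ • f (IccExtend (neg_le_self zero_le_one) u t)) t := by
  have h11 : (-1 : ℝ) ≤ 1 := by norm_num
  have hc : Continuous (fun s => f (IccExtend h11 u s)) := hf.comp u.continuous.Icc_extend'
  have h1 : HasDerivAt (fun r : ℝ => x + τ • ∫ s in (0 : ℝ)..r, f (IccExtend h11 u s))
      (τ • f (IccExtend h11 u t)) t :=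
    ((intervalIntegral.integral_hasDerivAt_right (hc.intervalIntegrable _ _)
      (hc.stronglyMeasurableAtFilter _ _) hc.continuousAt).const_smul τ).const_add x
  refine h1.congr_of_eventuallyEq ?_
  filter_upwards [Ioo_mem_nhds ht.1 ht.2] with r hr
  rw [IccExtend_of_mem _ _ ⟨hr.1.le, hr.2.le⟩]
  conv_lhs => rw [hu]
  rfl

end LocalFlow

/-! ### The flow of a vector field on a compact manifold -/

section Flow

variable {d : ℕ} {X : Type*} [TopologicalSpace X]
  [ChartedSpace (EuclideanSpace ℝ (Fin d)) X] [IsManifold (𝓡 d) ∞ X]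

/-- The coordinate expression of a vector field in the preferred chart at `x₀`, as a map of the
coordinate space to itself. -/
def chartVectorField (v : (x : X) → TangentSpace (𝓡 d) x) (x₀ : X)
    (y : EuclideanSpace ℝ (Fin d)) : EuclideanSpace ℝ (Fin d) :=
  mfderiv (𝓡 d) 𝓘(ℝ, EuclideanSpace ℝ (Fin d)) (extChartAt (𝓡 d) x₀)
    ((extChartAt (𝓡 d) x₀).symm y) (v ((extChartAt (𝓡 d) x₀).symm y))

theorem contDiffOn_chartVectorField {v : (x : X) → TangentSpace (𝓡 d) x}
    (hv : ContMDiff (𝓡 d) (𝓡 d).tangent ∞ (fun x => (⟨x, v x⟩ : TangentBundle (𝓡 d) X)))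
    (x₀ : X) :
    ContDiffOn ℝ ∞ (chartVectorField v x₀) (extChartAt (𝓡 d) x₀).target := by
  rw [← contMDiffOn_iff_contDiffOn]
  set T := trivializationAt (EuclideanSpace ℝ (Fin d)) (TangentSpace (𝓡 d) (M := X)) x₀
  have hbase : T.baseSet = (chartAt (EuclideanSpace ℝ (Fin d)) x₀).source := rfl
  have h1 : ContMDiffOn (𝓡 d) 𝓘(ℝ, EuclideanSpace ℝ (Fin d)) ∞
      (fun x => (T ⟨x, v x⟩).2) T.baseSet :=
    (T.contMDiffOn_section_iff T.open_baseSet subset_rfl).1 hv.contMDiffOn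
  have hmaps : MapsTo (extChartAt (𝓡 d) x₀).symm (extChartAt (𝓡 d) x₀).target T.baseSet := by
    intro y hy
    rw [hbase, ← extChartAt_source (𝓡 d)]
    exact (extChartAt (𝓡 d) x₀).map_target hy
  refine (h1.comp (contMDiffOn_extChartAt_symm x₀) hmaps).congr fun y hy => ?_
  have hx := hmaps hy
  have h2 := TangentBundle.continuousLinearMapAt_trivializationAt (I := 𝓡 d) (x₀ := x₀) hx
  have h3 := T.coe_linearMapAt_of_mem (R := ℝ) hx
  exact (congrArg (fun A => A (v ((extChartAt (𝓡 d) x₀).symm y))) h2).symm.trans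
    (congrFun h3 (v ((extChartAt (𝓡 d) x₀).symm y)))

/-- Local form of the smooth dependence on initial values, for a vector field on a manifold: the
value at time `1 / 2` of the integral curve of `τ • v` starting at `x` is a smooth function of
`(τ, x)` near `(0, x₀)`. Since `τ` rescales time, any fixed time in the open interval `(-1, 1)`
would serve instead of `1 / 2`. -/
theorem exists_contMDiffOn_integralCurve {v : (x : X) → TangentSpace (𝓡 d) x}
    (hv : ContMDiff (𝓡 d) (𝓡 d).tangent ∞ (fun x => (⟨x, v x⟩ : TangentBundle (𝓡 d) X)))
    (x₀ : X) :
    ∃ (W : Set (ℝ × X)) (Ψ : ℝ × X → X), IsOpen W ∧ ((0 : ℝ), x₀) ∈ W ∧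
      ContMDiffOn (𝓘(ℝ, ℝ).prod (𝓡 d)) (𝓡 d) ∞ Ψ W ∧
      ∀ q ∈ W, ∃ c : ℝ → X, c 0 = q.2 ∧ c (1 / 2) = Ψ q ∧
        IsMIntegralCurveOn (I := 𝓡 d) c (q.1 • v) (Ioo (-1 : ℝ) 1) := by
  set E := EuclideanSpace ℝ (Fin d)
  set e := extChartAt (𝓡 d) x₀ with he
  set y₀ := e x₀ with hy₀
  have hy₀t : y₀ ∈ e.target := mem_extChartAt_target x₀
  have het : IsOpen e.target := isOpen_extChartAt_target x₀
  set f₀ : E → E := chartVectorField v x₀ with hf₀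
  have hf₀s : ContDiffOn ℝ ∞ f₀ e.target := contDiffOn_chartVectorField hv x₀
  -- cut the coordinate expression off, to have a vector field on the whole coordinate space
  obtain ⟨r, hr, hball⟩ := Metric.isOpen_iff.1 het y₀ hy₀t
  set χ : ContDiffBump y₀ := ⟨r / 4, r / 2, by positivity, by linarith⟩ with hχ
  set f : E → E := fun y => χ y • f₀ y with hf
  have hfs : ContDiff ℝ ∞ f := by
    rw [contDiff_iff_contDiffAt]
    intro y
    by_cases hy : y ∈ tsupport χ
    · have hyt : y ∈ e.target := hball (by
        rw [χ.tsupport_eq] at hy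
        exact Metric.closedBall_subset_ball (by simp [hχ]; linarith) hy)
      exact χ.contDiff.contDiffAt.smul (hf₀s.contDiffAt (het.mem_nhds hyt))
    · have h0 : f =ᶠ[𝓝 y] fun _ => (0 : E) := by
        filter_upwards [notMem_tsupport_iff_eventuallyEq.1 hy] with z hz
        simp [hf, hz]
      exact contDiffAt_const.congr_of_eventuallyEq h0
  have hff₀ : ∀ y ∈ Metric.ball y₀ (r / 4), f y = f₀ y := by
    intro y hy
    simp [hf, χ.one_of_mem_closedBall (Metric.ball_subset_closedBall hy)]
  obtain ⟨s, U, hs, h0s, hUs, hU0, hU⟩ := exists_contDiffOn_solution hfs y₀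
  set V : Set (ℝ × E) := s ∩ U ⁻¹' Metric.ball (constL _ y₀) (r / 4) with hV
  have hVo : IsOpen V := hUs.continuousOn.isOpen_inter_preimage hs Metric.isOpen_ball
  have h0V : ((0 : ℝ), y₀) ∈ V := ⟨h0s, by
    rw [mem_preimage, hU0]; exact Metric.mem_ball_self (by positivity)⟩
  have hUball : ∀ q ∈ V, ∀ t, U q t ∈ Metric.ball y₀ (r / 4) := fun q hq t =>
    lt_of_le_of_lt (ContinuousMap.dist_apply_le_dist t) hq.2
  have hsub : Metric.ball y₀ (r / 4) ⊆ e.target :=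
    (Metric.ball_subset_ball (by linarith)).trans hball
  have hes : IsOpen e.source := isOpen_extChartAt_source x₀
  have hprod : ContMDiffOn (𝓘(ℝ, ℝ).prod (𝓡 d)) 𝓘(ℝ, ℝ × E) ∞
      (fun q : ℝ × X => (q.1, e q.2)) (univ ×ˢ e.source) := by
    rw [modelWithCornersSelf_prod, ← chartedSpaceSelf_prod]
    refine contMDiff_fst.contMDiffOn.prodMk
      ((contMDiffOn_extChartAt (x := x₀)).comp contMDiff_snd.contMDiffOn fun q hq => ?_)
    rw [← extChartAt_source (𝓡 d)]
    exact hq.2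
  set W : Set (ℝ × X) := (univ ×ˢ e.source) ∩ (fun q : ℝ × X => (q.1, e q.2)) ⁻¹' V with hW
  have h11 : (-1 : ℝ) ≤ 1 := neg_le_self zero_le_one
  set half : Icc (-1 : ℝ) 1 := ⟨1 / 2, by norm_num, by norm_num⟩ with hhalf
  refine ⟨W, fun q => e.symm (U (q.1, e q.2) half), ?_, ?_, ?_, ?_⟩
  · exact hprod.continuousOn.isOpen_inter_preimage (isOpen_univ.prod hes) hVo
  · exact ⟨⟨mem_univ _, mem_extChartAt_source x₀⟩, h0V⟩
  · have h1 : ContDiffOn ℝ ∞ (fun q => U q half) V :=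
      (ContinuousMap.evalCLM ℝ half : C(Icc (-1 : ℝ) 1, E) →L[ℝ] E).contDiff.comp_contDiffOn
        (hUs.mono inter_subset_left)
    have h2 : ContMDiffOn (𝓘(ℝ, ℝ).prod (𝓡 d)) 𝓘(ℝ, E) ∞
        (fun q : ℝ × X => U (q.1, e q.2) half) W :=
      h1.contMDiffOn.comp (hprod.mono inter_subset_left) fun q hq => hq.2
    exact (contMDiffOn_extChartAt_symm x₀).comp h2 fun q hq => hsub (hUball _ hq.2 half)
  · intro q hq
    set u := U (q.1, e q.2) with hu
    have hueq := hU _ hq.2.1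
    refine ⟨fun t => e.symm (IccExtend h11 u t), ?_, ?_, ?_⟩
    · have h0 : IccExtend h11 u 0 = e q.2 := by
        rw [IccExtend_of_mem _ _ (⟨by norm_num, by norm_num⟩ : (0 : ℝ) ∈ Icc (-1 : ℝ) 1), hu, hueq]
        simp [primitive_apply]
      simp only [h0]
      exact e.left_inv hq.1.2
    · have h0 : IccExtend h11 u (1 / 2) = u half := IccExtend_of_mem _ _ half.2
      simp only [h0]
      rfl
    · intro t ht
      have hd := hasDerivAt_of_eq_const_add_primitive hfs.continuous hueq ht
      set y := IccExtend h11 u t with hy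
      have hyb : y ∈ Metric.ball y₀ (r / 4) := hUball _ hq.2 _
      have hyt := hsub hyb
      have hsym : HasMFDerivAt 𝓘(ℝ, E) (𝓡 d) e.symm y (mfderiv 𝓘(ℝ, E) (𝓡 d) e.symm y) :=
        (((contMDiffOn_extChartAt_symm (n := ∞) x₀).contMDiffAt
          (het.mem_nhds hyt)).mdifferentiableAt (by simp)).hasMFDerivAt
      have hcomp := hsym.comp t hd.hasFDerivAt.hasMFDerivAt
      have hid := mfderivWithin_extChartAt_symm_comp_mfderiv_extChartAt (I := 𝓡 d) hyt
      rw [show range (𝓡 d) = univ from ModelWithCorners.range_eq_univ _, mfderivWithin_univ] at hid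
      refine HasMFDerivAt.hasMFDerivWithinAt ?_
      have hvy : mfderiv 𝓘(ℝ, E) (𝓡 d) e.symm y (f₀ y) = v (e.symm y) :=
        congrArg (fun A => A (v (e.symm y))) hid
      have hL : (1 : ℝ →L[ℝ] ℝ).smulRight ((q.1 • v) (e.symm y)) =
          (mfderiv 𝓘(ℝ, E) (𝓡 d) e.symm y).comp
            (ContinuousLinearMap.toSpanSingleton ℝ (q.1 • f y)) := by
        refine ContinuousLinearMap.ext_ring ?_
        rw [hff₀ y hyb]
        have h1 : mfderiv 𝓘(ℝ, E) (𝓡 d) e.symm y (q.1 • f₀ y) = q.1 • v (e.symm y) :=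
          (map_smul (mfderiv 𝓘(ℝ, E) (𝓡 d) e.symm y) q.1 (f₀ y)).trans
            (congrArg (fun w => q.1 • w) hvy)
        refine (one_smul ℝ (q.1 • v (e.symm y))).trans (h1.symm.trans ?_)
        exact congrArg (mfderiv 𝓘(ℝ, E) (𝓡 d) e.symm y) (one_smul ℝ (q.1 • f₀ y)).symm
      exact hL ▸ hcomp

/-- The flow of a smooth vector field on a compact manifold: it is defined for all times, it is a
one-parameter group, and it is jointly smooth. -/
theorem exists_contMDiff_flow [T2Space X] [CompactSpace X] {v : (x : X) → TangentSpace (𝓡 d) x}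
    (hv : ContMDiff (𝓡 d) (𝓡 d).tangent ∞ (fun x => (⟨x, v x⟩ : TangentBundle (𝓡 d) X))) :
    ∃ Φ : ℝ → X → X, (∀ x, Φ 0 x = x) ∧ (∀ s t x, Φ (s + t) x = Φ s (Φ t x)) ∧
      ContMDiff (𝓘(ℝ, ℝ).prod (𝓡 d)) (𝓡 d) ∞ (fun q : ℝ × X => Φ q.1 q.2) ∧
      ∀ x, IsMIntegralCurve (I := 𝓡 d) (fun t => Φ t x) v := by
  have hv1 : ContMDiff (𝓡 d) (𝓡 d).tangent 1
      (fun x => (⟨x, v x⟩ : TangentBundle (𝓡 d) X)) := hv.of_le (by simp)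
  choose W Ψ hWo h0W hΨ hcurve using fun x₀ : X => exists_contMDiffOn_integralCurve hv x₀
  -- integral curves exist for a uniform time, hence for all times
  have hunif : ∀ᶠ τ in 𝓝 (0 : ℝ), ∀ x ∈ (univ : Set X), ∃ c : ℝ → X, c 0 = x ∧
      IsMIntegralCurveOn (I := 𝓡 d) c (τ • v) (Ioo (-1 : ℝ) 1) := by
    refine isCompact_univ.eventually_forall_of_forall_eventually fun x _ => ?_
    filter_upwards [(hWo x).mem_nhds (h0W x)] with q hq
    obtain ⟨c, hc0, -, hc⟩ := hcurve x q hq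
    exact ⟨c, hc0, hc⟩
  obtain ⟨δ, hδ, hδu⟩ := Metric.eventually_nhds_iff.1 hunif
  have hglob : ∀ x : X, ∃ γ : ℝ → X, γ 0 = x ∧ IsMIntegralCurve (I := 𝓡 d) γ v := by
    have hτ : (0 : ℝ) < δ / 2 := by positivity
    refine exists_isMIntegralCurve_of_isMIntegralCurveOn hv1 hτ fun x => ?_
    obtain ⟨c, hc0, hc⟩ := hδu (y := δ / 2) (by
      rw [Real.dist_eq, sub_zero, abs_of_pos hτ]; linarith) x (mem_univ x)
    refine ⟨c ∘ (· * (δ / 2)⁻¹), by simp [hc0], ?_⟩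
    have h1 := hc.comp_mul (δ / 2)⁻¹
    rw [smul_smul, inv_mul_cancel₀ hτ.ne', one_smul] at h1
    refine h1.mono fun t ht => ?_
    have h2 : -1 < t / (δ / 2) := by rw [lt_div_iff₀ hτ]; linarith [ht.1]
    have h3 : t / (δ / 2) < 1 := by rw [div_lt_iff₀ hτ]; linarith [ht.2]
    exact ⟨by rwa [← div_eq_mul_inv], by rwa [← div_eq_mul_inv]⟩
  choose γ hγ0 hγ using hglob
  have hadd : ∀ s t x, γ x (s + t) = γ (γ x t) s := by
    intro s t x
    have h1 := (hγ x).comp_add t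
    have h2 := isMIntegralCurve_Ioo_eq_of_contMDiff_boundaryless (t₀ := 0) hv1 h1 (hγ (γ x t))
      (by simp [hγ0])
    exact congrFun h2 s
  -- joint smoothness at time zero comes from the local solutions
  have hloc : ∀ x₀, ∀ᶠ q : ℝ × X in 𝓝 (0, x₀),
      ContMDiffAt (𝓘(ℝ, ℝ).prod (𝓡 d)) (𝓡 d) ∞ (fun q : ℝ × X => γ q.2 q.1) q := by
    intro x₀
    have hmul : ContMDiff (𝓘(ℝ, ℝ).prod (𝓡 d)) (𝓘(ℝ, ℝ).prod (𝓡 d)) ∞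
        (fun q : ℝ × X => (2 * q.1, q.2)) :=
      ((contDiff_const.mul contDiff_id).contMDiff.comp contMDiff_fst).prodMk contMDiff_snd
    have hmem : (fun q : ℝ × X => (2 * q.1, q.2)) ⁻¹' W x₀ ∈ 𝓝 ((0 : ℝ), x₀) :=
      ((hWo x₀).preimage hmul.continuous).mem_nhds (by simpa using h0W x₀)
    filter_upwards [eventually_mem_nhds_iff.2 hmem] with q hq
    have hq' : q ∈ (fun q : ℝ × X => (2 * q.1, q.2)) ⁻¹' W x₀ := mem_of_mem_nhds hq
    have h1 : ContMDiffAt (𝓘(ℝ, ℝ).prod (𝓡 d)) (𝓡 d) ∞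
        (fun q : ℝ × X => Ψ x₀ (2 * q.1, q.2)) q :=
      ContMDiffAt.comp q ((hΨ x₀).contMDiffAt ((hWo x₀).mem_nhds hq'))
        hmul.contMDiffAt
    refine h1.congr_of_eventuallyEq ?_
    filter_upwards [hq] with z hz
    obtain ⟨c, hc0, hc, hcc⟩ := hcurve x₀ _ hz
    have h2 := ((hγ z.2).comp_mul (2 * z.1)).isMIntegralCurveOn (Ioo (-1 : ℝ) 1)
    have h3 := isMIntegralCurveOn_Ioo_eqOn_of_contMDiff_boundaryless (t₀ := 0) (by norm_num)
      (hv1.const_smul_section (a := 2 * z.1)) h2 hcc (by simp [hγ0, hc0])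
    have h4 := h3 (by norm_num : (1 / 2 : ℝ) ∈ Ioo (-1 : ℝ) 1)
    rw [hc] at h4
    rw [← h4]
    simp only [Function.comp]
    congr 1
    ring
  have hunif2 : ∀ᶠ t in 𝓝 (0 : ℝ), ∀ x ∈ (univ : Set X),
      ContMDiffAt (𝓘(ℝ, ℝ).prod (𝓡 d)) (𝓡 d) ∞ (fun q : ℝ × X => γ q.2 q.1) (t, x) :=
    isCompact_univ.eventually_forall_of_forall_eventually fun x _ => hloc x
  obtain ⟨η, hη, hηu⟩ := Metric.eventually_nhds_iff.1 hunif2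
  have hsmall : ∀ t : ℝ, |t| < η → ContMDiff (𝓡 d) (𝓡 d) ∞ (fun x => γ x t) := by
    intro t ht x
    have h1 := hηu (y := t) (by rwa [Real.dist_eq, sub_zero]) x (mem_univ x)
    exact ContMDiffAt.comp (f := fun x : X => (t, x)) x h1
      (contMDiff_const.prodMk contMDiff_id).contMDiffAt
  -- the group law extends smoothness from small times to all times
  have hmulti : ∀ t : ℝ, |t| < η → ∀ N : ℕ, ContMDiff (𝓡 d) (𝓡 d) ∞ (fun x => γ x (N * t)) := by
    intro t ht N
    induction N with
    | zero =>
      simp only [Nat.cast_zero, zero_mul, hγ0]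
      exact contMDiff_id
    | succ N ih =>
      have h1 : (fun x => γ x ((N + 1 : ℕ) * t)) = (fun x => γ x t) ∘ fun x => γ x (N * t) := by
        funext x
        simp only [Function.comp, ← hadd]
        congr 1
        push_cast
        ring
      rw [h1]
      exact (hsmall t ht).comp ih
  have hall : ∀ t : ℝ, ContMDiff (𝓡 d) (𝓡 d) ∞ (fun x => γ x t) := by
    intro t
    obtain ⟨N, hN⟩ := exists_nat_gt (|t| / η)
    have hNpos : (0 : ℝ) < N := lt_of_le_of_lt (by positivity) hN
    have h1 := hmulti (t / N) (by
      rw [abs_div, abs_of_pos hNpos, div_lt_iff₀ hNpos]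
      rwa [div_lt_iff₀ hη, mul_comm] at hN) N
    rwa [mul_div_cancel₀ t hNpos.ne'] at h1
  refine ⟨fun t x => γ x t, hγ0, hadd, fun q => ?_, hγ⟩
  -- joint smoothness at time `q.1` follows from that at time zero, again by the group law
  have h1 : (fun z : ℝ × X => γ z.2 z.1) =
      (fun z : ℝ × X => γ z.2 z.1) ∘ fun z : ℝ × X => (z.1 - q.1, γ z.2 q.1) := by
    funext z
    simp only [Function.comp, ← hadd]
    congr 1
    ring
  rw [h1]
  have h2 : ContMDiff (𝓘(ℝ, ℝ).prod (𝓡 d)) (𝓘(ℝ, ℝ).prod (𝓡 d)) ∞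
      (fun z : ℝ × X => (z.1 - q.1, γ z.2 q.1)) :=
    ((contDiff_id.sub contDiff_const).contMDiff.comp contMDiff_fst).prodMk
      ((hall q.1).comp contMDiff_snd)
  have h3 : ContMDiffAt (𝓘(ℝ, ℝ).prod (𝓡 d)) (𝓡 d) ∞ (fun z : ℝ × X => γ z.2 z.1)
      (q.1 - q.1, γ q.2 q.1) := by
    rw [sub_self]
    exact (hloc (γ q.2 q.1)).self_of_nhds
  exact ContMDiffAt.comp q h3 h2.contMDiffAt

end Flow

/-! ### Zero sets of functions without critical zeros -/

/-- Tangent spaces are copies of the model space, and transport along an equality of base points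
does not change the underlying vector. -/
theorem eqRec_tangentSpace {d : ℕ} {X : Type*} [TopologicalSpace X]
    [ChartedSpace (EuclideanSpace ℝ (Fin d)) X] {x y : X} (h : y = x) (u : TangentSpace (𝓡 d) y)
    (v : TangentSpace (𝓡 d) x) (huv : (u : EuclideanSpace ℝ (Fin d)) = v) :
    (h ▸ u : TangentSpace (𝓡 d) x) = v := by
  subst h
  exact huv

/-- The differential of a real-valued function at `x`, as a linear functional on the tangent
space. -/
def differentialAt {d : ℕ} {X : Type*} [TopologicalSpace X]
    [ChartedSpace (EuclideanSpace ℝ (Fin d)) X] (φ : X → ℝ) (x : X) :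
    TangentSpace (𝓡 d) x →L[ℝ] ℝ :=
  mfderiv (𝓡 d) 𝓘(ℝ, ℝ) φ x

section ZeroSets

variable {d : ℕ} {X : Type*} [TopologicalSpace X]
  [ChartedSpace (EuclideanSpace ℝ (Fin d)) X] [IsManifold (𝓡 d) ∞ X]

theorem mem_contDiffGroupoid_of_contDiffOn
    {g : OpenPartialHomeomorph (EuclideanSpace ℝ (Fin d)) (EuclideanSpace ℝ (Fin d))}
    (hg : ContDiffOn ℝ ∞ g g.source) (hg' : ContDiffOn ℝ ∞ g.symm g.target) :
    g ∈ contDiffGroupoid ∞ (𝓡 d) := by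
  rw [contDiffGroupoid, mem_groupoid_of_pregroupoid]
  simp only [contDiffPregroupoid, modelWithCornersSelf_coe, modelWithCornersSelf_coe_symm,
    Function.comp_id, Function.id_comp, preimage_id, range_id, inter_univ]
  exact ⟨hg, hg'⟩

theorem trans_mem_maximalAtlas {c : OpenPartialHomeomorph X (EuclideanSpace ℝ (Fin d))}
    (hc : c ∈ atlas (EuclideanSpace ℝ (Fin d)) X)
    {g : OpenPartialHomeomorph (EuclideanSpace ℝ (Fin d)) (EuclideanSpace ℝ (Fin d))}
    (hg : g ∈ contDiffGroupoid ∞ (𝓡 d)) :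
    c.trans g ∈ IsManifold.maximalAtlas (𝓡 d) ∞ X := by
  rw [IsManifold.mem_maximalAtlas_iff, mem_maximalAtlas_iff]
  intro e' he'
  constructor
  · rw [OpenPartialHomeomorph.trans_symm_eq_symm_trans_symm, OpenPartialHomeomorph.trans_assoc]
    exact (contDiffGroupoid ∞ (𝓡 d)).trans ((contDiffGroupoid ∞ (𝓡 d)).symm hg)
      ((contDiffGroupoid ∞ (𝓡 d)).compatible hc he')
  · rw [← OpenPartialHomeomorph.trans_assoc]
    exact (contDiffGroupoid ∞ (𝓡 d)).trans ((contDiffGroupoid ∞ (𝓡 d)).compatible he' hc) hg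

/-- Near a non-critical point, a smooth function is linear in a suitable chart. -/
theorem exists_chart_linear {φ : X → ℝ} (hφ : ContMDiff (𝓡 d) 𝓘(ℝ, ℝ) ∞ φ) {x : X}
    (hx : differentialAt (d := d) φ x ≠ 0) :
    ∃ e ∈ IsManifold.maximalAtlas (𝓡 d) ∞ X, x ∈ e.source ∧
      ∃ l : EuclideanSpace ℝ (Fin d) →L[ℝ] ℝ, l ≠ 0 ∧ ∀ y ∈ e.source, φ y = l (e y) := by
  set E := EuclideanSpace ℝ (Fin d)
  set c := chartAt E x with hc
  set y₀ : E := c x with hy₀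
  set f : E → ℝ := φ ∘ c.symm with hf
  have hct : IsOpen c.target := c.open_target
  have hy₀t : y₀ ∈ c.target := mem_chart_target E x
  have hfs : ContDiffOn ℝ ∞ f c.target := by
    rw [← contMDiffOn_iff_contDiffOn]
    exact hφ.comp_contMDiffOn (contMDiffOn_chart_symm (I := 𝓡 d))
  have hfd : HasFDerivAt f (fderiv ℝ f y₀) y₀ :=
    ((hfs.contDiffAt (hct.mem_nhds hy₀t)).differentiableAt (by simp)).hasFDerivAt
  set l := fderiv ℝ f y₀ with hl
  have hl0 : l ≠ 0 := by
    intro h0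
    apply hx
    have h1 : HasMFDerivAt (𝓡 d) 𝓘(ℝ, E) c x (mfderiv (𝓡 d) 𝓘(ℝ, E) c x) :=
      (((contMDiffAt_of_mem_maximalAtlas (I := 𝓡 d) (n := ∞)
        (IsManifold.chart_mem_maximalAtlas x) (mem_chart_source E x))).mdifferentiableAt
          (by simp)).hasMFDerivAt
    have h2 : HasMFDerivAt 𝓘(ℝ, E) 𝓘(ℝ, ℝ) f (c x) (0 : E →L[ℝ] ℝ) := by
      rw [← h0]; exact hfd.hasMFDerivAt
    have h3 := h2.comp x h1
    have h4 : φ =ᶠ[𝓝 x] f ∘ c := by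
      filter_upwards [c.open_source.mem_nhds (mem_chart_source E x)] with z hz
      simp [f, c.left_inv hz]
    rw [differentialAt, h4.mfderiv_eq, h3.mfderiv]
    exact ContinuousLinearMap.zero_comp _
  obtain ⟨v, hv⟩ : ∃ v, l v = 1 := by
    obtain ⟨u, hu⟩ := ContinuousLinearMap.exists_ne_zero hl0
    exact ⟨(l u)⁻¹ • u, by simp [hu]⟩
  -- correct the identity along `v` so that `l ∘ G = f`; the correction has zero differential
  set G : E → E := fun y => y + (f y - l y) • v with hG
  have hGs : ContDiffOn ℝ ∞ G c.target :=
    contDiffOn_id.add ((hfs.sub l.contDiff.contDiffOn).smul contDiffOn_const)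
  have hGd : HasFDerivAt G ((ContinuousLinearEquiv.refl ℝ E : E ≃L[ℝ] E) : E →L[ℝ] E) y₀ := by
    have h1 := (hasFDerivAt_id y₀).add ((hfd.sub l.hasFDerivAt).smul_const v)
    convert! h1 using 1
    ext z
    simp
  obtain ⟨g, hg, hgy, hgs, hgsymm⟩ :=
    exists_openPartialHomeomorph_contDiffOn_symm hct hGs hy₀t (ContinuousLinearEquiv.refl ℝ E) hGd
  have hgg : g ∈ contDiffGroupoid ∞ (𝓡 d) :=
    mem_contDiffGroupoid_of_contDiffOn (by rw [hg]; exact hGs.mono hgs) hgsymm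
  refine ⟨c.trans g, trans_mem_maximalAtlas (chart_mem_atlas E x) hgg, ?_, l, hl0, ?_⟩
  · rw [OpenPartialHomeomorph.trans_source]
    exact ⟨mem_chart_source E x, hgy⟩
  · intro y hy
    rw [OpenPartialHomeomorph.trans_source] at hy
    rw [OpenPartialHomeomorph.coe_trans, Function.comp, hg]
    simp [G, hv, f, c.left_inv hy.1]

theorem isSubmanifold_zeroSet {φ : X → ℝ} (hφ : ContMDiff (𝓡 d) 𝓘(ℝ, ℝ) ∞ φ)
    (hreg : ∀ x, φ x = 0 → differentialAt (d := d) φ x ≠ 0) :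
    IsSubmanifold (d := d) 1 {x | φ x = 0} := by
  intro x hx
  obtain ⟨e, he, hxe, l, hl, hle⟩ := exists_chart_linear hφ (hreg x hx)
  refine ⟨e, he, hxe, LinearMap.ker l.toLinearMap, ?_, ?_⟩
  · have h1 := Module.Dual.finrank_ker_add_one_of_ne_zero (f := l.toLinearMap) (by
      intro h; apply hl; ext z; exact congrArg (fun A => A z) h)
    simpa using h1
  · intro y hy
    simp [hle y hy]

/-- Tangent vectors in the kernel of the differential of a function are tangent to its zero set,
near a non-critical zero. -/
theorem mem_tangentSpaceOf_zeroSet {φ : X → ℝ} (hφ : ContMDiff (𝓡 d) 𝓘(ℝ, ℝ) ∞ φ) {x : X}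
    (hx : differentialAt (d := d) φ x ≠ 0) (hx0 : φ x = 0) {v : TangentSpace (𝓡 d) x}
    (hv : differentialAt φ x v = 0) :
    v ∈ tangentSpaceOf (d := d) {x | φ x = 0} x := by
  set E := EuclideanSpace ℝ (Fin d)
  obtain ⟨e, he, hxe, l, hl, hle⟩ := exists_chart_linear hφ hx
  have he1 : HasMFDerivAt (𝓡 d) 𝓘(ℝ, E) e x (mfderiv (𝓡 d) 𝓘(ℝ, E) e x) :=
    ((contMDiffAt_of_mem_maximalAtlas he hxe).mdifferentiableAt (by simp)).hasMFDerivAt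
  have hes : ContMDiffAt 𝓘(ℝ, E) (𝓡 d) ∞ e.symm (e x) :=
    contMDiffAt_symm_of_mem_maximalAtlas he (e.map_source hxe)
  have he2 : HasMFDerivAt 𝓘(ℝ, E) (𝓡 d) e.symm (e x) (mfderiv 𝓘(ℝ, E) (𝓡 d) e.symm (e x)) :=
    (hes.mdifferentiableAt (by simp)).hasMFDerivAt
  set w : E := mfderiv (𝓡 d) 𝓘(ℝ, E) e x v with hw
  have hnhds : ∀ᶠ z in 𝓝 x, z ∈ e.source := e.open_source.mem_nhds hxe
  have hlw : l w = 0 := by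
    have h1 : HasMFDerivAt (𝓡 d) 𝓘(ℝ, ℝ) (l ∘ e) x (l.comp (mfderiv (𝓡 d) 𝓘(ℝ, E) e x)) :=
      l.hasFDerivAt.hasMFDerivAt.comp x he1
    have h2 : φ =ᶠ[𝓝 x] l ∘ e := hnhds.mono fun z hz => hle z hz
    rw [differentialAt, h2.mfderiv_eq, h1.mfderiv] at hv
    exact hv
  have hinv : (mfderiv 𝓘(ℝ, E) (𝓡 d) e.symm (e x) w : E) = v := by
    have h1 := he2.comp x he1
    have h2 : (e.symm ∘ e) =ᶠ[𝓝 x] id := hnhds.mono fun z hz => e.left_inv hz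
    have h3 := h1.mfderiv
    rw [h2.mfderiv_eq, mfderiv_id] at h3
    exact (congrArg (fun A => A v) h3).symm
  set δ : ℝ → E := fun t => e x + t • w with hδ
  have hδs : ContDiff ℝ ∞ δ := contDiff_const.add (contDiff_id.smul contDiff_const)
  have hδ0 : δ 0 = e x := by simp [δ]
  have hmem : δ ⁻¹' e.target ∈ 𝓝 (0 : ℝ) :=
    (e.open_target.preimage hδs.continuous).mem_nhds (by
      rw [mem_preimage, hδ0]; exact e.map_source hxe)
  obtain ⟨ε, hε, hball⟩ := Metric.mem_nhds_iff.1 hmem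
  rw [Real.ball_eq_Ioo, zero_sub, zero_add] at hball
  have hγ0 : (e.symm ∘ δ) 0 = x := by simp [hδ0, e.left_inv hxe]
  refine Submodule.subset_span ⟨e.symm ∘ δ, ε, hγ0, hε, ?_, ?_, ?_⟩
  · exact (contMDiffOn_symm_of_mem_maximalAtlas he).comp hδs.contMDiff.contMDiffOn hball
  · intro t ht
    have ht' : δ t ∈ e.target := hball ht
    have h1 := hle _ (e.map_target ht')
    rw [e.right_inv ht'] at h1
    have h2 : l (e x) = 0 := by rw [← hle x hxe, hx0]
    simp only [mem_ofPred_eq, Function.comp, h1]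
    simp [δ, h2, hlw]
  · apply eqRec_tangentSpace
    have h1 : HasDerivAt δ w 0 :=
      (((hasDerivAt_id (0 : ℝ)).smul_const w).const_add (e x)).congr_deriv (one_smul ℝ w)
    have h2 : HasMFDerivAt 𝓘(ℝ, E) (𝓡 d) e.symm (δ 0) (mfderiv 𝓘(ℝ, E) (𝓡 d) e.symm (e x)) := by
      rw [hδ0]; exact he2
    have h3 := h2.comp (0 : ℝ) h1.hasFDerivAt.hasMFDerivAt
    rw [h3.mfderiv]
    refine Eq.trans ?_ hinv
    exact congrArg (mfderiv 𝓘(ℝ, E) (𝓡 d) e.symm (e x)) (one_smul ℝ w)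

/-- Zero sets of two functions intersect transversally if no non-trivial linear combination of the
functions has a critical point at a common zero. -/
theorem intersectTransversally_zeroSets {φ ψ : X → ℝ} (hφ : ContMDiff (𝓡 d) 𝓘(ℝ, ℝ) ∞ φ)
    (hψ : ContMDiff (𝓡 d) 𝓘(ℝ, ℝ) ∞ ψ)
    (hreg : ∀ x, φ x = 0 → ψ x = 0 → ∀ a b : ℝ,
      a • differentialAt (d := d) φ x + b • differentialAt (d := d) ψ x = 0 → a = 0 ∧ b = 0) :
    IntersectTransversally (d := d) {x | φ x = 0} {x | ψ x = 0} := by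
  rintro x ⟨hφx, hψx⟩
  have hind := hreg x hφx hψx
  set E := EuclideanSpace ℝ (Fin d)
  set f := differentialAt (d := d) φ x with hf
  set g := differentialAt (d := d) ψ x with hg
  have hf0 : f ≠ 0 := fun h => one_ne_zero (hind 1 0 (by rw [h]; simp)).1
  have hg0 : g ≠ 0 := fun h => one_ne_zero (hind 0 1 (by rw [h]; simp)).2
  -- a vector on which `f` vanishes and `g` does not
  obtain ⟨v, hfv, hgv⟩ : ∃ v, f v = 0 ∧ g v ≠ 0 := by
    by_contra! hall
    obtain ⟨u, hu⟩ := ContinuousLinearMap.exists_ne_zero hf0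
    refine hf0 ?_
    have h1 := hind (g u) (-f u) (by
      ext z
      have h2 := hall (f u • z - f z • u) (by simp [mul_comm])
      simp only [map_sub, map_smul, smul_eq_mul] at h2
      simp only [add_apply, smul_apply, smul_eq_mul, zero_apply]
      linarith)
    exact absurd (neg_eq_zero.1 h1.2) hu
  rw [eq_top_iff]
  intro z _
  have hz : z = (g z / g v) • v + (z - (g z / g v) • v) := by abel
  rw [hz]
  refine Submodule.add_mem_sup ?_ ?_
  · exact mem_tangentSpaceOf_zeroSet hφ hf0 hφx (by
      change f _ = 0
      simp [hfv])
  · refine mem_tangentSpaceOf_zeroSet hψ hg0 hψx ?_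
    change g _ = 0
    simp [hgv]

end ZeroSets

/-! ### Isotopies between the zero sets of a pencil of functions -/

/-- The image of a smooth vector field under the differential of a smooth map is smooth. -/
theorem contMDiffAt_mfderiv_apply {E E' H H' Y Z : Type*} [NormedAddCommGroup E]
    [NormedSpace ℝ E] [NormedAddCommGroup E'] [NormedSpace ℝ E'] [TopologicalSpace H]
    [TopologicalSpace H'] {I : ModelWithCorners ℝ E H} {I' : ModelWithCorners ℝ E' H'}
    [TopologicalSpace Y] [ChartedSpace H Y] [IsManifold I ∞ Y]
    [TopologicalSpace Z] [ChartedSpace H' Z] [IsManifold I' ∞ Z]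
    {h : Y → Z} {v : (y : Y) → TangentSpace I y} {y₀ : Y} (hh : ContMDiffAt I I' ∞ h y₀)
    (hv : ContMDiffAt I I.tangent ∞ (fun y => (⟨y, v y⟩ : TangentBundle I Y)) y₀) :
    ContMDiffAt I I'.tangent ∞ (fun y => (⟨h y, mfderiv I I' h y (v y)⟩ : TangentBundle I' Z)) y₀ :=
  ContMDiffAt.clm_apply_of_inCoordinates (b₁ := fun y : Y => y) (b₂ := h)
    (ϕ := fun y => mfderiv I I' h y) (v := v) (hh.mfderiv_const (m := ∞) (by simp)) hv hh

section Pencil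

variable {d : ℕ} {X : Type*} [TopologicalSpace X]
  [ChartedSpace (EuclideanSpace ℝ (Fin d)) X]

/-- No non-trivial linear combination of the two functions has a critical point among its zeros. -/
def IsRegularPencil (f g : X → ℝ) : Prop :=
  ∀ (x : X) (a b : ℝ), a * f x + b * g x = 0 →
    a • differentialAt (d := d) f x + b • differentialAt (d := d) g x = 0 → a = 0 ∧ b = 0

/-- A vector at `x` rotates the pencil spanned by `f` and `g` if it moves `(f, g)` infinitesimally
by the rotation `(-g, f)` and a dilation of rate at most `K`. The dilation cannot be avoided where
the differentials of `f` and `g` are dependent; it does not affect zero sets. -/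
def RotatesPencil (f g : X → ℝ) (K : ℝ) (x : X) (v : TangentSpace (𝓡 d) x) : Prop :=
  ∃ h : ℝ, |h| ≤ K ∧ differentialAt f x v = -g x + h * f x ∧
    differentialAt g x v = f x + h * g x

theorem convex_rotatesPencil (f g : X → ℝ) (K : ℝ) (x : X) :
    Convex ℝ {v : TangentSpace (𝓡 d) x | RotatesPencil f g K x v} := by
  rintro v ⟨h, hK, hf, hg⟩ v' ⟨h', hK', hf', hg'⟩ a b ha hb hab
  refine ⟨a * h + b * h', ?_, ?_, ?_⟩
  · calc |a * h + b * h'| ≤ |a * h| + |b * h'| := abs_add_le _ _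
      _ = a * |h| + b * |h'| := by rw [abs_mul, abs_mul, abs_of_nonneg ha, abs_of_nonneg hb]
      _ ≤ a * K + b * K := by gcongr
      _ = K := by rw [← add_mul, hab, one_mul]
  · rw [map_add, map_smul, map_smul, hf, hf']
    simp only [smul_eq_mul]
    linear_combination (-g x) * hab
  · rw [map_add, map_smul, map_smul, hg, hg']
    simp only [smul_eq_mul]
    linear_combination (f x) * hab

/-- The derivative of a function along an integral curve. -/
theorem hasDerivAt_comp_integralCurve {φ : X → ℝ} (hφ : ContMDiff (𝓡 d) 𝓘(ℝ, ℝ) ∞ φ)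
    {s : (x : X) → TangentSpace (𝓡 d) x} {γ : ℝ → X} (hγ : IsMIntegralCurve (I := 𝓡 d) γ s)
    (t : ℝ) : HasDerivAt (fun t => φ (γ t)) (differentialAt φ (γ t) (s (γ t))) t := by
  have h1 : HasMFDerivAt (𝓡 d) 𝓘(ℝ, ℝ) φ (γ t) (differentialAt φ (γ t)) :=
    (hφ.mdifferentiableAt (by simp)).hasMFDerivAt
  set L : ℝ →L[ℝ] ℝ :=
    (differentialAt φ (γ t)).comp ((1 : ℝ →L[ℝ] ℝ).smulRight (s (γ t))) with hL
  have h2 : HasFDerivAt (φ ∘ γ) L t := (h1.comp t (hγ t)).hasFDerivAt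
  refine h2.hasDerivAt.congr_deriv ?_
  exact congrArg (differentialAt φ (γ t)) (one_smul ℝ (s (γ t)))

variable [IsManifold (𝓡 d) ∞ X]

theorem contMDiffAt_differentialAt_apply {φ : X → ℝ} (hφ : ContMDiff (𝓡 d) 𝓘(ℝ, ℝ) ∞ φ)
    {v : (x : X) → TangentSpace (𝓡 d) x} {x₀ : X}
    (hv : ContMDiffAt (𝓡 d) (𝓡 d).tangent ∞ (fun y => (⟨y, v y⟩ : TangentBundle (𝓡 d) X)) x₀) :
    ContMDiffAt (𝓡 d) 𝓘(ℝ, ℝ) ∞ (fun y => differentialAt φ y (v y)) x₀ :=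
  ContMDiffAt.comp x₀ (contMDiff_snd_tangentBundle_modelSpace ℝ 𝓘(ℝ, ℝ)).contMDiffAt
    (contMDiffAt_mfderiv_apply hφ.contMDiffAt hv)

/-- A regular pencil is rotated by a smooth vector field near each point. -/
theorem exists_local_rotatesPencil {f g : X → ℝ} (hf : ContMDiff (𝓡 d) 𝓘(ℝ, ℝ) ∞ f)
    (hg : ContMDiff (𝓡 d) 𝓘(ℝ, ℝ) ∞ g) (hreg : IsRegularPencil (d := d) f g) (x₀ : X) :
    ∃ K : ℝ, ∃ s : (x : X) → TangentSpace (𝓡 d) x,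
      (∀ᶠ x in 𝓝 x₀, ContMDiffAt (𝓡 d) (𝓡 d).tangent ∞
        (fun y => (⟨y, s y⟩ : TangentBundle (𝓡 d) X)) x) ∧
      ∀ᶠ x in 𝓝 x₀, RotatesPencil f g K x (s x) := by
  set E := EuclideanSpace ℝ (Fin d)
  have hext : ∀ v : TangentSpace (𝓡 d) x₀, ∃ V : (x : X) → TangentSpace (𝓡 d) x, V x₀ = v ∧
      ∀ᶠ x in 𝓝 x₀, ContMDiffAt (𝓡 d) (𝓡 d).tangent ∞
        (fun y => (⟨y, V y⟩ : TangentBundle (𝓡 d) X)) x := by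
    intro v
    obtain ⟨u, hu, hsm⟩ := FiberBundle.exists_contMDiffOn_extend (k := ∞) (𝓡 d) E v
    refine ⟨FiberBundle.extend E v, by simp, ?_⟩
    filter_upwards [eventually_mem_nhds_iff.2 hu] with x hx
    exact hsm.contMDiffAt hx
  by_cases h0 : f x₀ = 0 ∧ g x₀ = 0
  · -- at a common zero the pair `(f, g)` is a submersion, and `(-g, f)` can be lifted
    have hdet : ∃ v v' : TangentSpace (𝓡 d) x₀,
        differentialAt f x₀ v * differentialAt g x₀ v'
          - differentialAt f x₀ v' * differentialAt g x₀ v ≠ 0 := by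
      by_contra! hall
      have h1 : ∀ v : TangentSpace (𝓡 d) x₀,
          differentialAt f x₀ v = 0 ∧ differentialAt g x₀ v = 0 := by
        intro v
        have h2 := hreg x₀ (differentialAt g x₀ v) (-differentialAt f x₀ v) (by simp [h0]) (by
          ext v'
          have := hall v' v
          simp only [add_apply, smul_apply, smul_eq_mul, zero_apply]
          linarith)
        exact ⟨neg_eq_zero.1 h2.2, h2.1⟩
      have h3 := hreg x₀ 1 0 (by simp [h0]) (by
        ext v
        simp [(h1 v).1])
      exact one_ne_zero h3.1
    obtain ⟨v, v', hdet⟩ := hdet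
    obtain ⟨V, hV0, hV⟩ := hext v
    obtain ⟨V', hV'0, hV'⟩ := hext v'
    set a : X → ℝ := fun x => differentialAt f x (V x) with ha
    set b : X → ℝ := fun x => differentialAt f x (V' x) with hb
    set c : X → ℝ := fun x => differentialAt g x (V x) with hc
    set e : X → ℝ := fun x => differentialAt g x (V' x) with he
    set D : X → ℝ := fun x => a x * e x - b x * c x with hD
    have hDs : ∀ x, ContMDiffAt (𝓡 d) (𝓡 d).tangent ∞
        (fun y => (⟨y, V y⟩ : TangentBundle (𝓡 d) X)) x →
        ContMDiffAt (𝓡 d) (𝓡 d).tangent ∞ (fun y => (⟨y, V' y⟩ : TangentBundle (𝓡 d) X)) x →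
        ContMDiffAt (𝓡 d) 𝓘(ℝ, ℝ) ∞ D x := fun x h h' =>
      ((contMDiffAt_differentialAt_apply hf h).mul (contMDiffAt_differentialAt_apply hg h')).sub
        ((contMDiffAt_differentialAt_apply hf h').mul (contMDiffAt_differentialAt_apply hg h))
    have hD0 : D x₀ ≠ 0 := by simpa [D, a, b, c, e, hV0, hV'0] using hdet
    have hDne : ∀ᶠ x in 𝓝 x₀, D x ≠ 0 :=
      (hDs x₀ hV.self_of_nhds hV'.self_of_nhds).continuousAt.eventually_ne hD0
    -- Cramer's rule for `df = -g`, `dg = f` on the span of `V` and `V'`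
    refine ⟨0, fun x => ((-g x * e x - b x * f x) / D x) • V x
      + ((a x * f x + c x * g x) / D x) • V' x, ?_, ?_⟩
    · filter_upwards [hV, hV', hDne] with x hx hx' hxD
      have hDx := hDs x hx hx'
      have hp : ContMDiffAt (𝓡 d) 𝓘(ℝ, ℝ) ∞ (fun x => (-g x * e x - b x * f x) / D x) x :=
        ((hg.contMDiffAt.neg.mul (contMDiffAt_differentialAt_apply hg hx')).sub
          ((contMDiffAt_differentialAt_apply hf hx').mul hf.contMDiffAt)).div₀ hDx hxD
      have hq : ContMDiffAt (𝓡 d) 𝓘(ℝ, ℝ) ∞ (fun x => (a x * f x + c x * g x) / D x) x :=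
        (((contMDiffAt_differentialAt_apply hf hx).mul hf.contMDiffAt).add
          ((contMDiffAt_differentialAt_apply hg hx).mul hg.contMDiffAt)).div₀ hDx hxD
      exact (hp.smul_section hx).add_section (hq.smul_section hx')
    · filter_upwards [hDne] with x hxD
      refine ⟨0, by simp, ?_, ?_⟩
      · rw [map_add, map_smul, map_smul]
        change (-g x * e x - b x * f x) / D x * a x + (a x * f x + c x * g x) / D x * b x = _
        field_simp
        simp only [hD]
        ring
      · rw [map_add, map_smul, map_smul]
        change (-g x * e x - b x * f x) / D x * c x + (a x * f x + c x * g x) / D x * e x = _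
        field_simp
        simp only [hD]
        ring
  · -- elsewhere the polar angle of `(f, g)` has no critical point, and it can be advanced
    have hr0 : 0 < f x₀ ^ 2 + g x₀ ^ 2 := by
      rcases not_and_or.1 h0 with h | h
      · have := sq_pos_of_ne_zero h; positivity
      · have := sq_pos_of_ne_zero h; positivity
    obtain ⟨v, hv⟩ : ∃ v : TangentSpace (𝓡 d) x₀,
        f x₀ * differentialAt g x₀ v - g x₀ * differentialAt f x₀ v ≠ 0 := by
      by_contra! hall
      have h1 := hreg x₀ (-g x₀) (f x₀) (by ring) (by
        ext v
        have := hall v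
        simp only [add_apply, smul_apply, smul_eq_mul, zero_apply]
        linarith)
      exact h0 ⟨h1.2, neg_eq_zero.1 h1.1⟩
    obtain ⟨V, hV0, hV⟩ := hext v
    set a : X → ℝ := fun x => differentialAt f x (V x) with ha
    set c : X → ℝ := fun x => differentialAt g x (V x) with hc
    set q : X → ℝ := fun x => f x * c x - g x * a x with hq
    set r : X → ℝ := fun x => f x ^ 2 + g x ^ 2 with hr
    have hrs : ContMDiff (𝓡 d) 𝓘(ℝ, ℝ) ∞ r := (hf.pow 2).add (hg.pow 2)
    have hqs : ∀ x, ContMDiffAt (𝓡 d) (𝓡 d).tangent ∞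
        (fun y => (⟨y, V y⟩ : TangentBundle (𝓡 d) X)) x → ContMDiffAt (𝓡 d) 𝓘(ℝ, ℝ) ∞ q x :=
      fun x h => (hf.contMDiffAt.mul (contMDiffAt_differentialAt_apply hg h)).sub
        (hg.contMDiffAt.mul (contMDiffAt_differentialAt_apply hf h))
    have hq0 : q x₀ ≠ 0 := by simpa [q, a, c, hV0] using hv
    have hqne : ∀ᶠ x in 𝓝 x₀, q x ≠ 0 :=
      (hqs x₀ hV.self_of_nhds).continuousAt.eventually_ne hq0
    have hrne : ∀ᶠ x in 𝓝 x₀, r x ≠ 0 := hrs.contMDiffAt.continuousAt.eventually_ne hr0.ne'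
    -- along `(r / q) • V` the angle advances at unit speed, and `h` is the rate of dilation
    set h : X → ℝ := fun x => (f x * a x + g x * c x) / q x with hh
    have hhc : ContinuousAt h x₀ :=
      (((hf.contMDiffAt.mul (contMDiffAt_differentialAt_apply hf hV.self_of_nhds)).add
        (hg.contMDiffAt.mul (contMDiffAt_differentialAt_apply hg hV.self_of_nhds))).div₀
          (hqs x₀ hV.self_of_nhds) hq0).continuousAt
    have hhK : ∀ᶠ x in 𝓝 x₀, |h x| < |h x₀| + 1 :=
      hhc.abs.eventually_lt_const (lt_add_one _)
    refine ⟨|h x₀| + 1, fun x => (r x / q x) • V x, ?_, ?_⟩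
    · filter_upwards [hV, hqne] with x hx hxq
      exact ((hrs.contMDiffAt).div₀ (hqs x hx) hxq).smul_section hx
    · filter_upwards [hqne, hhK] with x hxq hxK
      refine ⟨h x, hxK.le, ?_, ?_⟩
      · rw [map_smul]
        change r x / q x * a x = -g x + (f x * a x + g x * c x) / q x * f x
        field_simp
        simp only [hq, hr]
        ring
      · rw [map_smul]
        change r x / q x * c x = f x + (f x * a x + g x * c x) / q x * g x
        field_simp
        simp only [hq, hr]
        ring

/-- A regular pencil on a compact manifold is rotated by a global vector field, with a uniform
bound on the rate of dilation. -/
theorem exists_vectorField_rotatesPencil [T2Space X] [CompactSpace X] {f g : X → ℝ}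
    (hf : ContMDiff (𝓡 d) 𝓘(ℝ, ℝ) ∞ f) (hg : ContMDiff (𝓡 d) 𝓘(ℝ, ℝ) ∞ g)
    (hreg : IsRegularPencil (d := d) f g) :
    ∃ K : ℝ, ∃ s : (x : X) → TangentSpace (𝓡 d) x,
      ContMDiff (𝓡 d) (𝓡 d).tangent ∞ (fun y => (⟨y, s y⟩ : TangentBundle (𝓡 d) X)) ∧
      ∀ x, RotatesPencil f g K x (s x) := by
  choose K s hs hrot using exists_local_rotatesPencil hf hg hreg
  set U : X → Set X := fun x₀ => {x | ContMDiffAt (𝓡 d) (𝓡 d).tangent ∞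
    (fun y => (⟨y, s x₀ y⟩ : TangentBundle (𝓡 d) X)) x ∧ RotatesPencil f g (K x₀) x (s x₀ x)}
  have hU : ∀ x₀, U x₀ ∈ 𝓝 x₀ := fun x₀ => (hs x₀).and (hrot x₀)
  obtain ⟨t, ht⟩ := CompactSpace.elim_nhds_subcover (fun x => interior (U x))
    (fun x => interior_mem_nhds.2 (hU x))
  obtain ⟨C, hC⟩ := (t.image K).exists_le
  obtain ⟨S, hS⟩ := exists_contMDiffSection_forall_mem_convex_of_local (n := ⊤) (𝓡 d)
    (F_fiber := EuclideanSpace ℝ (Fin d)) (TangentSpace (𝓡 d) (M := X))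
    (fun x => {v | RotatesPencil f g C x v}) (fun x => convex_rotatesPencil f g C x) (by
      intro x₀
      have hx₀ : x₀ ∈ ⋃ x ∈ t, interior (U x) := ht ▸ mem_univ x₀
      simp only [mem_iUnion] at hx₀
      obtain ⟨y, hy, hx₀y⟩ := hx₀
      refine ⟨interior (U y), isOpen_interior.mem_nhds hx₀y, s y, fun x hx =>
        (interior_subset hx).1.contMDiffWithinAt, fun x hx => ?_⟩
      obtain ⟨h, hh, h1, h2⟩ := (interior_subset hx).2
      exact ⟨h, hh.trans (hC _ (Finset.mem_image_of_mem K hy)), h1, h2⟩)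
  exact ⟨C, S, S.contMDiff, hS⟩

end Pencil

/-- A solution of a linear differential inequality that vanishes at one time vanishes at all
times. -/
theorem eq_zero_of_abs_deriv_le_mul_abs {ψ ψ' : ℝ → ℝ} {K : ℝ}
    (hψ : ∀ t, HasDerivAt ψ (ψ' t) t) (hb : ∀ t, |ψ' t| ≤ K * |ψ t|) {a : ℝ} (ha : ψ a = 0)
    (t : ℝ) : ψ t = 0 := by
  have key : ∀ {ψ ψ' : ℝ → ℝ} (_ : ∀ t, HasDerivAt ψ (ψ' t) t) (_ : ∀ t, |ψ' t| ≤ K * |ψ t|)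
      {a : ℝ} (_ : ψ a = 0) (t : ℝ) (_ : a ≤ t), ψ t = 0 := by
    intro ψ ψ' hψ hb a ha t hat
    exact eq_zero_of_abs_deriv_le_mul_abs_self_of_eq_zero_right (K := K) (b := t)
      (fun s _ => (hψ s).continuousAt.continuousWithinAt) (fun s _ => (hψ s).hasDerivWithinAt) ha
      (fun s _ => hb s) t ⟨hat, le_rfl⟩
  rcases le_total a t with hat | hat
  · exact key hψ hb ha t hat
  · have h1 : ∀ s, HasDerivAt (fun s => ψ (-s)) (-ψ' (-s)) s := fun s =>
      ((hψ (-s)).comp s (hasDerivAt_neg s)).congr_deriv (mul_neg_one _)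
    have h2 := key h1 (fun s => by simpa using hb (-s)) (a := -a) (by simpa using ha) (-t)
      (by linarith)
    simpa using h2

section Pencil

variable {d : ℕ} {X : Type*} [TopologicalSpace X]
  [ChartedSpace (EuclideanSpace ℝ (Fin d)) X] [IsManifold (𝓡 d) ∞ X]

/-- The zero sets of the members of a regular pencil on a compact manifold are isotopic: the flow
of a vector field that rotates the pencil at unit speed carries them to each other. -/
theorem areIsotopic_zeroSets_of_isRegularPencil [T2Space X] [CompactSpace X] {f g : X → ℝ}
    (hf : ContMDiff (𝓡 d) 𝓘(ℝ, ℝ) ∞ f) (hg : ContMDiff (𝓡 d) 𝓘(ℝ, ℝ) ∞ g)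
    (hreg : IsRegularPencil (d := d) f g) (β : ℝ) :
    AreIsotopic (d := d) {x | f x = 0} {x | Real.cos β * f x + Real.sin β * g x = 0} := by
  obtain ⟨K, s, hs, hrot⟩ := exists_vectorField_rotatesPencil hf hg hreg
  obtain ⟨Φ, hΦ0, hΦadd, hΦs, hΦc⟩ := exists_contMDiff_flow hs
  have hsm : ∀ t, ContMDiff (𝓡 d) (𝓡 d) ∞ (Φ t) := fun t =>
    hΦs.comp (contMDiff_const.prodMk contMDiff_id : ContMDiff (𝓡 d) (𝓘(ℝ, ℝ).prod (𝓡 d)) ∞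
      fun x : X => (t, x))
  have hinv : ∀ t x, Φ (-t) (Φ t x) = x := fun t x => by rw [← hΦadd, neg_add_cancel, hΦ0]
  have hinv' : ∀ t x, Φ t (Φ (-t) x) = x := fun t x => by rw [← hΦadd, add_neg_cancel, hΦ0]
  -- along the flow, the rotating member of the pencil satisfies a linear differential equation
  have hzero : ∀ x, f x = 0 ↔ Real.cos β * f (Φ β x) + Real.sin β * g (Φ β x) = 0 := by
    intro x
    choose h hhK hhf hhg using hrot
    set ψ : ℝ → ℝ := fun t => Real.cos t * f (Φ t x) + Real.sin t * g (Φ t x) with hψ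
    have hd : ∀ t, HasDerivAt ψ (h (Φ t x) * ψ t) t := by
      intro t
      have h1 := hasDerivAt_comp_integralCurve hf (hΦc x) t
      have h2 := hasDerivAt_comp_integralCurve hg (hΦc x) t
      have h3 := ((Real.hasDerivAt_cos t).mul h1).add ((Real.hasDerivAt_sin t).mul h2)
      refine h3.congr_deriv ?_
      rw [hhf, hhg]
      simp only [hψ]
      ring
    have hb : ∀ t, |h (Φ t x) * ψ t| ≤ K * |ψ t| := fun t => by
      rw [abs_mul]
      exact mul_le_mul_of_nonneg_right (hhK _) (abs_nonneg _)
    have h0 : ψ 0 = f x := by simp [hψ, hΦ0]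
    constructor
    · intro hx
      exact eq_zero_of_abs_deriv_le_mul_abs hd hb (h0.trans hx) β
    · intro hx
      rw [← h0]
      exact eq_zero_of_abs_deriv_le_mul_abs hd hb (a := β) hx 0
  refine ⟨fun t =>
    { toFun := Φ (t * β)
      invFun := Φ (-(t * β))
      left_inv := hinv _
      right_inv := hinv' _
      contMDiff_toFun := hsm _
      contMDiff_invFun := hsm _ }, ?_, ?_, ?_⟩
  · have h1 : ContMDiff (𝓘(ℝ, ℝ).prod (𝓡 d)) (𝓘(ℝ, ℝ).prod (𝓡 d)) ∞
        (fun q : ℝ × X => (q.1 * β, q.2)) :=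
      ((contDiff_id.mul contDiff_const).contMDiff.comp contMDiff_fst).prodMk contMDiff_snd
    exact (hΦs.comp h1).contMDiffOn
  · intro x
    change Φ (0 * β) x = x
    rw [zero_mul, hΦ0]
  · change Φ (1 * β) '' _ = _
    rw [one_mul]
    ext y
    constructor
    · rintro ⟨x, hx, rfl⟩
      exact (hzero x).1 hx
    · intro hy
      refine ⟨Φ (-β) y, (hzero _).2 ?_, hinv' β y⟩
      rw [hinv']
      exact hy

end Pencil

/-! ### Alternating forms with a vector in their kernel -/

section Kernel

variable {V : Type*} [AddCommGroup V] [Module ℝ V]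

/-- `X` lies in the kernel of the alternating form `a`: the form vanishes as soon as one of its
arguments is `X`. -/
def InKernel {ι : Type*} (X : V) (a : V [⋀^ι]→ₗ[ℝ] ℝ) : Prop :=
  ∀ (v : ι → V) (i : ι), v i = X → a v = 0

/-- In each shuffle, the argument `X` ends up in one of the two factors. -/
theorem InKernel.wedge {X : V} {k l : ℕ} {a : V [⋀^Fin k]→ₗ[ℝ] ℝ} {b : V [⋀^Fin l]→ₗ[ℝ] ℝ}
    (ha : InKernel X a) (hb : InKernel X b) : InKernel X (wedge a b) := by
  intro v i hi
  have h1 : ContactSphere.wedge a b v =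
      LinearMap.mul' ℝ ℝ (a.domCoprod b (v ∘ finSumFinEquiv)) := rfl
  have h2 : a.domCoprod b (v ∘ finSumFinEquiv) = (∑ σ : Equiv.Perm.ModSumCongr (Fin k) (Fin l),
      AlternatingMap.domCoprod.summand a b σ) (v ∘ finSumFinEquiv) := rfl
  rw [h1, h2, sum_apply, map_sum]
  refine Finset.sum_eq_zero fun σ _ => ?_
  induction σ using Quotient.inductionOn' with
  | h σ =>
    rw [AlternatingMap.domCoprod.summand_mk'']
    simp only [smul_apply, MultilinearMap.domDomCongr_apply,
      MultilinearMap.domCoprod_apply, AlternatingMap.coe_multilinearMap]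
    obtain ⟨j, hj⟩ : ∃ j, finSumFinEquiv (σ j) = i := ⟨σ.symm (finSumFinEquiv.symm i), by simp⟩
    have hzero : (a fun i₁ => (v ∘ finSumFinEquiv) (σ (Sum.inl i₁))) = 0 ∨
        (b fun i₂ => (v ∘ finSumFinEquiv) (σ (Sum.inr i₂))) = 0 := by
      rcases j with j | j
      · exact Or.inl (ha _ j (by simp only [Function.comp]; rw [hj, hi]))
      · exact Or.inr (hb _ j (by simp only [Function.comp]; rw [hj, hi]))
    rcases hzero with h | h
    · rw [h, TensorProduct.zero_tmul, smul_zero, map_zero]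
    · rw [h, TensorProduct.tmul_zero, smul_zero, map_zero]

theorem InKernel.wedgePow {X : V} {b : V [⋀^Fin 2]→ₗ[ℝ] ℝ} (hb : InKernel X b) (n : ℕ) :
    InKernel X (wedgePow b n) := by
  induction n with
  | zero => exact fun _ i => i.elim0
  | succ n ih => exact ih.wedge hb

/-- A form of top degree with a non-zero vector in its kernel vanishes. -/
theorem InKernel.eq_zero_of_card_eq_finrank [FiniteDimensional ℝ V] {ι : Type*} [Fintype ι]
    [DecidableEq ι] {X : V} (hX : X ≠ 0) {a : V [⋀^ι]→ₗ[ℝ] ℝ} (ha : InKernel X a)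
    (hcard : Fintype.card ι = Module.finrank ℝ V) : a = 0 := by
  ext v
  by_cases hv : LinearIndependent ℝ v
  · have hspan := hv.span_eq_top_of_card_eq_finrank' hcard
    obtain ⟨c, hc⟩ := (Submodule.mem_span_range_iff_exists_fun ℝ).1 (hspan ▸ Submodule.mem_top :
      X ∈ Submodule.span ℝ (range v))
    obtain ⟨j, hj⟩ : ∃ j, c j ≠ 0 := by
      by_contra! h
      exact hX (by rw [← hc]; simp [h])
    have h1 : a (Function.update v j X) = 0 := ha _ j (by simp)
    rw [← hc, AlternatingMap.map_update_sum, Finset.sum_eq_single j] at h1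
    · rw [AlternatingMap.map_update_smul, Function.update_eq_self, smul_eq_mul] at h1
      exact (mul_eq_zero.1 h1).resolve_left hj
    · intro i _ hij
      rw [AlternatingMap.map_update_smul, AlternatingMap.map_update_self _ _ hij.symm, smul_zero]
    · simp
  · exact a.map_linearDependent v hv

end Kernel

/-! ### Contact forms and their vertical coefficients -/

section InChart

variable {d : ℕ} {X : Type*} [TopologicalSpace X]
  [ChartedSpace (EuclideanSpace ℝ (Fin d)) X] [IsManifold (𝓡 d) ∞ X]

/-- The covector of the coordinate expression of a 1-form, as an element of the dual space. -/
def OneForm.inChartCLM (w : OneForm d X) (x : X) (y : EuclideanSpace ℝ (Fin d)) :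
    EuclideanSpace ℝ (Fin d) →L[ℝ] ℝ :=
  (w ((extChartAt (𝓡 d) x).symm y)).comp
    (mfderiv 𝓘(ℝ, EuclideanSpace ℝ (Fin d)) (𝓡 d) (extChartAt (𝓡 d) x).symm y)

/-- Covectors as alternating forms of degree 1, as a continuous linear map. -/
def ofSubsingletonL (E : Type*) [NormedAddCommGroup E] [NormedSpace ℝ E] :
    (E →L[ℝ] ℝ) →L[ℝ] (E [⋀^Fin 1]→L[ℝ] ℝ) :=
  LinearMap.mkContinuous
    { toFun := ContinuousAlternatingMap.ofSubsingleton ℝ E ℝ (0 : Fin 1)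
      map_add' := fun _ _ => rfl
      map_smul' := fun _ _ => rfl } 1 (fun f => by
    rw [one_mul]
    exact (ContinuousAlternatingMap.norm_ofSubsingleton (0 : Fin 1) f).le)

theorem OneForm.inChart_eq (w : OneForm d X) (x : X) :
    w.inChart x = fun y => ofSubsingletonL _ (w.inChartCLM x y) := rfl

theorem OneForm.differentiableAt_inChartCLM (w : OneForm d X) (x : X) :
    DifferentiableAt ℝ (w.inChartCLM x) (extChartAt (𝓡 d) x x) := by
  set E := EuclideanSpace ℝ (Fin d)
  have h1 := (contMDiffAt_hom_bundle _).1 (w.contMDiff x)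
  have h2 := h1.2
  have h3 : ContMDiffAt 𝓘(ℝ, E) (𝓡 d) ∞ (extChartAt (𝓡 d) x).symm (extChartAt (𝓡 d) x x) :=
    (contMDiffOn_extChartAt_symm x).contMDiffAt (extChartAt_target_mem_nhds x)
  have h4 := (h2.comp_of_eq h3 (extChartAt_to_inv x)).contDiffAt.differentiableAt (by simp)
  refine h4.congr_of_eventuallyEq ?_
  filter_upwards [extChartAt_target_mem_nhds (I := 𝓡 d) x] with y hy
  have hys : (extChartAt (𝓡 d) x).symm y ∈ (chartAt E x).source := by
    rw [← extChartAt_source (𝓡 d)]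
    exact (extChartAt (𝓡 d) x).map_target hy
  -- the trivialization of the tangent bundle at `x` is inverse to the differential of the inverse
  -- chart, so the bundle coordinates of `w` are its chart expression
  have h5 := TangentBundle.symmL_trivializationAt (I := 𝓡 d) hys
  rw [(extChartAt (𝓡 d) x).right_inv hy, show range (𝓡 d) = univ from
    ModelWithCorners.range_eq_univ _, mfderivWithin_univ] at h5
  ext v
  have h6 := congrArg (fun A => w ((extChartAt (𝓡 d) x).symm y) (A v)) h5
  have h7 (b : X) (r : ℝ) : Bundle.Trivialization.continuousLinearMapAt ℝ
      (trivializationAt ℝ (fun _ : X => ℝ) x) b r = r :=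
    congrArg (fun A => A r) (Bundle.Trivial.continuousLinearMapAt_trivialization (𝕜 := ℝ) X ℝ b)
  exact h6.symm.trans (h7 _ _).symm

theorem OneForm.differentiableAt_inChart (w : OneForm d X) (x : X) :
    DifferentiableAt ℝ (w.inChart x) (extChartAt (𝓡 d) x x) := by
  rw [w.inChart_eq]
  exact (ofSubsingletonL _).differentiableAt.comp _ (w.differentiableAt_inChartCLM x)

end InChart

section Regularity

variable {d e : ℕ} {B M : Type*} [TopologicalSpace B]
  [ChartedSpace (EuclideanSpace ℝ (Fin d)) B] [IsManifold (𝓡 d) ∞ B] [TopologicalSpace M]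
  [ChartedSpace (EuclideanSpace ℝ (Fin e)) M] [IsManifold (𝓡 e) ∞ M]

theorem InKernel.alternatingAt {w : OneForm e M} {x : M} {V : TangentSpace (𝓡 e) x}
    (h : w x V = 0) : InKernel V (w.alternatingAt x) := by
  intro v i hi
  obtain rfl : i = 0 := Subsingleton.elim _ _
  have h1 : w.alternatingAt x v = w x (v 0) := rfl
  rw [h1, hi, h]

/-- Near the image of `x` in a chart, the coordinate expression of `w = pr^*(η) + pr^*(φ) α` is
the pullback of the coordinate expression of `η` under the coordinate expression of `pr`, plus a
multiple of the coordinate expression of `α`. -/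
theorem Decomposes.inChart_eventuallyEq {pr : M → B} {α w : OneForm e M} {η : OneForm d B}
    {φ : B → ℝ} (hpr : ContMDiff (𝓡 e) (𝓡 d) ∞ pr) (h : Decomposes pr α w η φ) (x : M) :
    w.inChart x =ᶠ[𝓝 (extChartAt (𝓡 e) x x)]
      (fun y => (η.inChart (pr x)
          ((extChartAt (𝓡 d) (pr x) ∘ pr ∘ (extChartAt (𝓡 e) x).symm) y)).compContinuousLinearMap
        (fderiv ℝ (extChartAt (𝓡 d) (pr x) ∘ pr ∘ (extChartAt (𝓡 e) x).symm) y)) +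
      fun y => (φ ∘ pr ∘ (extChartAt (𝓡 e) x).symm) y • α.inChart x y := by
  set E := EuclideanSpace ℝ (Fin e)
  set F := EuclideanSpace ℝ (Fin d)
  set s := (extChartAt (𝓡 e) x).symm
  set κ := extChartAt (𝓡 d) (pr x)
  set Q : E → B := pr ∘ s
  set P : E → F := κ ∘ Q
  have hs : ∀ y ∈ (extChartAt (𝓡 e) x).target, ContMDiffAt 𝓘(ℝ, E) (𝓡 e) ∞ s y := fun y hy =>
    (contMDiffOn_extChartAt_symm x).contMDiffAt ((isOpen_extChartAt_target x).mem_nhds hy)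
  have hx := mem_extChartAt_target (I := 𝓡 e) x
  have hQ : ∀ y ∈ (extChartAt (𝓡 e) x).target, ContMDiffAt 𝓘(ℝ, E) (𝓡 d) ∞ Q y := fun y hy =>
    hpr.contMDiffAt.comp y (hs y hy)
  have hQx : Q (extChartAt (𝓡 e) x x) = pr x := congrArg pr (extChartAt_to_inv x)
  have hev : ∀ᶠ y in 𝓝 (extChartAt (𝓡 e) x x), Q y ∈ κ.source := by
    refine (hQ _ hx).continuousAt.eventually_mem ?_
    rw [hQx]
    exact extChartAt_source_mem_nhds (pr x)
  filter_upwards [hev.eventually_nhds, extChartAt_target_mem_nhds (I := 𝓡 e) x] with y hy hyt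
  have hyκ := hy.self_of_nhds
  have hκ : ContMDiffAt (𝓡 d) 𝓘(ℝ, F) ∞ κ (Q y) :=
    contMDiffAt_extChartAt' (by rwa [← extChartAt_source (𝓡 d)])
  have hP : MDifferentiableAt 𝓘(ℝ, E) 𝓘(ℝ, F) P y :=
    (hκ.comp y (hQ y hyt)).mdifferentiableAt (by simp)
  have hκs : MDifferentiableAt 𝓘(ℝ, F) (𝓡 d) κ.symm (P y) :=
    ((contMDiffOn_extChartAt_symm (n := ∞) (pr x)).contMDiffAt
      ((isOpen_extChartAt_target (pr x)).mem_nhds (κ.map_source hyκ))).mdifferentiableAt (by simp)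
  -- `pr ∘ s` and `κ.symm ∘ P` agree near `y`, but their tangent spaces are not syntactically equal
  have hcongr : ∀ (z₁ z₂ : B) (A₁ A₂ : E →L[ℝ] F), z₁ = z₂ → A₁ = A₂ →
      ContinuousLinearMap.comp (η z₁ : F →L[ℝ] ℝ) A₁ =
      ContinuousLinearMap.comp (η z₂ : F →L[ℝ] ℝ) A₂ := by
    rintro _ _ _ _ rfl rfl
    rfl
  have hd1 : mfderiv 𝓘(ℝ, E) (𝓡 d) Q y =
      (mfderiv (𝓡 e) (𝓡 d) pr (s y)).comp (mfderiv 𝓘(ℝ, E) (𝓡 e) s y) :=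
    mfderiv_comp y (hpr.mdifferentiableAt (by simp)) ((hs y hyt).mdifferentiableAt (by simp))
  have hd2 : mfderiv 𝓘(ℝ, E) (𝓡 d) (κ.symm ∘ P) y =
      (mfderiv 𝓘(ℝ, F) (𝓡 d) κ.symm (P y)).comp (mfderiv 𝓘(ℝ, E) 𝓘(ℝ, F) P y) :=
    mfderiv_comp y hκs hP
  have hd3 : (mfderiv 𝓘(ℝ, E) (𝓡 d) Q y : E →L[ℝ] F) =
      mfderiv 𝓘(ℝ, E) (𝓡 d) (κ.symm ∘ P) y :=
    Filter.EventuallyEq.mfderiv_eq (by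
      filter_upwards [hy] with z hz
      exact (κ.left_inv hz).symm)
  have hkey := hcongr (Q y) (κ.symm (P y)) _ _ (κ.left_inv hyκ).symm
    (hd1.symm.trans (hd3.trans (hd2.trans (by rw [mfderiv_eq_fderiv]))))
  have hw : w.inChartCLM x y = (η.inChartCLM (pr x) (P y)).comp (fderiv ℝ P y) +
      φ (Q y) • α.inChartCLM x y := by
    let A : E →L[ℝ] F := ContinuousLinearMap.comp (mfderiv (𝓡 e) (𝓡 d) pr (s y) : E →L[ℝ] F)
      (mfderiv 𝓘(ℝ, E) (𝓡 e) s y)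
    have h1 : w.inChartCLM x y = ContinuousLinearMap.comp (η (Q y) : F →L[ℝ] ℝ) A +
        φ (Q y) • α.inChartCLM x y := by
      ext v
      exact congrArg (fun A => A (mfderiv 𝓘(ℝ, E) (𝓡 e) s y v)) (h (s y))
    rw [h1]
    exact congrArg (· + φ (Q y) • α.inChartCLM x y) hkey
  have hfin : w.inChart x y = ofSubsingletonL E ((η.inChartCLM (pr x) (P y)).comp (fderiv ℝ P y)) +
      φ (Q y) • ofSubsingletonL E (α.inChartCLM x y) := by
    rw [← map_smul, ← map_add, ← hw]
    rfl
  exact hfin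

/-- If the vertical coefficient `φ` vanishes at `pr x` together with its differential, then the
kernel of the differential of `pr` at `x` lies in the kernel of `dw`. -/
theorem Decomposes.inKernel_extDerivAt {pr : M → B} {α w : OneForm e M} {η : OneForm d B}
    {φ : B → ℝ} (hpr : ContMDiff (𝓡 e) (𝓡 d) ∞ pr) (hφ : ContMDiff (𝓡 d) 𝓘(ℝ, ℝ) ∞ φ)
    (h : Decomposes pr α w η φ) {x : M} (h0 : φ (pr x) = 0)
    (h1 : differentialAt (d := d) φ (pr x) = 0) {V : TangentSpace (𝓡 e) x}
    (hV : mfderiv (𝓡 e) (𝓡 d) pr x V = 0) : InKernel V (w.extDerivAt x) := by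
  set E := EuclideanSpace ℝ (Fin e)
  set F := EuclideanSpace ℝ (Fin d)
  set y₀ := extChartAt (𝓡 e) x x
  set s := (extChartAt (𝓡 e) x).symm
  set κ := extChartAt (𝓡 d) (pr x)
  set P : E → F := κ ∘ pr ∘ s with hPdef
  set ψ : E → ℝ := φ ∘ pr ∘ s with hψdef
  have hsx : s y₀ = x := extChartAt_to_inv x
  have hs : ContMDiffAt 𝓘(ℝ, E) (𝓡 e) ∞ s y₀ :=
    (contMDiffOn_extChartAt_symm x).contMDiffAt (extChartAt_target_mem_nhds x)
  have hQ : ContMDiffAt 𝓘(ℝ, E) (𝓡 d) ∞ (pr ∘ s) y₀ := hpr.contMDiffAt.comp y₀ hs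
  have hP : ContDiffAt ℝ ∞ P y₀ := by
    have : ContMDiffAt (𝓡 d) 𝓘(ℝ, F) ∞ κ ((pr ∘ s) y₀) := by
      rw [show (pr ∘ s) y₀ = pr x from congrArg pr hsx]
      exact contMDiffAt_extChartAt
    exact (this.comp y₀ hQ).contDiffAt
  have hPx : P y₀ = κ (pr x) := congrArg (κ ∘ pr) hsx
  have hψ0 : ψ y₀ = 0 := (congrArg (φ ∘ pr) hsx).trans h0
  have hφ' : MDifferentiableAt (𝓡 d) 𝓘(ℝ, ℝ) φ ((pr ∘ s) y₀) := hφ.mdifferentiableAt (by simp)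
  have hψd : DifferentiableAt ℝ ψ y₀ :=
    (hφ'.comp y₀ (hQ.mdifferentiableAt (by simp))).differentiableAt
  have hψ1 : fderiv ℝ ψ y₀ = 0 := by
    have hz : ∀ z : B, z = pr x → (mfderiv (𝓡 d) 𝓘(ℝ, ℝ) φ z : F →L[ℝ] ℝ) = 0 := by
      rintro _ rfl
      exact h1
    have h2 : mfderiv 𝓘(ℝ, E) 𝓘(ℝ, ℝ) ψ y₀ = (mfderiv (𝓡 d) 𝓘(ℝ, ℝ) φ ((pr ∘ s) y₀)).comp
        (mfderiv 𝓘(ℝ, E) (𝓡 d) (pr ∘ s) y₀) :=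
      mfderiv_comp y₀ hφ' (hQ.mdifferentiableAt (by simp))
    rw [← mfderiv_eq_fderiv, h2]
    ext v
    exact congrArg (fun A : F →L[ℝ] ℝ => A (mfderiv 𝓘(ℝ, E) (𝓡 d) (pr ∘ s) y₀ v))
      (hz _ (congrArg pr hsx))
  have hα := α.differentiableAt_inChart x
  have hη : DifferentiableAt ℝ (η.inChart (pr x)) (P y₀) := by
    rw [hPx]
    exact η.differentiableAt_inChart (pr x)
  have hsum := (h.inChart_eventuallyEq hpr x).extDeriv_eq
  -- the second summand vanishes to first order, so only the pullback contributes to `dw`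
  have hd2 : HasFDerivAt (fun y => ψ y • α.inChart x y) (0 : E →L[ℝ] _) y₀ := by
    have := hψd.hasFDerivAt.smul hα.hasFDerivAt
    rw [hψ0, hψ1, zero_smul] at this
    refine HasFDerivAt.congr_fderiv this ?_
    ext
    simp
  have hpull := extDeriv_pullback (r := ∞) hη hP
    (by rw [minSmoothness_of_isRCLikeNormedField]; exact WithTop.coe_le_coe.2 le_top)
  have hd1 : DifferentiableAt ℝ (fun y => (η.inChart (pr x) (P y)).compContinuousLinearMap
      (fderiv ℝ P y)) y₀ := by
    have hfd : DifferentiableAt ℝ (fderiv ℝ P) y₀ :=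
      (hP.fderiv_right (m := 1) (WithTop.coe_le_coe.2 le_top)).differentiableAt (by simp)
    exact (hη.comp y₀ (hP.differentiableAt
      (by simp))).continuousAlternatingMapCompContinuousLinearMap hfd
  have hext : extDeriv (w.inChart x) y₀ =
      (extDeriv (η.inChart (pr x)) (P y₀)).compContinuousLinearMap (fderiv ℝ P y₀) := by
    rw [hsum, extDeriv_add hd1 hd2.differentiableAt, hpull,
      show extDeriv (fun y => ψ y • α.inChart x y) y₀ = 0 by
        rw [extDeriv, hd2.fderiv]
        exact map_zero (ContinuousAlternatingMap.alternatizeUncurryFinCLM ℝ E ℝ), add_zero]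
  have hLV : fderiv ℝ P y₀ (mfderiv (𝓡 e) 𝓘(ℝ, E) (extChartAt (𝓡 e) x) x V) = 0 := by
    have h2 : mfderiv (𝓡 e) 𝓘(ℝ, F) (P ∘ extChartAt (𝓡 e) x) x =
        (mfderiv 𝓘(ℝ, E) 𝓘(ℝ, F) P y₀).comp (mfderiv (𝓡 e) 𝓘(ℝ, E) (extChartAt (𝓡 e) x) x) :=
      mfderiv_comp x (hP.differentiableAt (by simp)).mdifferentiableAt
        (mdifferentiableAt_extChartAt (mem_chart_source E x))
    have h3 : (mfderiv (𝓡 e) 𝓘(ℝ, F) (P ∘ extChartAt (𝓡 e) x) x : E →L[ℝ] F) =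
        mfderiv (𝓡 e) 𝓘(ℝ, F) (κ ∘ pr) x :=
      Filter.EventuallyEq.mfderiv_eq (by
        filter_upwards [extChartAt_source_mem_nhds (I := 𝓡 e) x] with z hz
        exact congrArg (κ ∘ pr) ((extChartAt (𝓡 e) x).left_inv hz))
    have h4 : mfderiv (𝓡 e) 𝓘(ℝ, F) (κ ∘ pr) x =
        (mfderiv (𝓡 d) 𝓘(ℝ, F) κ (pr x)).comp (mfderiv (𝓡 e) (𝓡 d) pr x) :=
      mfderiv_comp x (mdifferentiableAt_extChartAt (mem_chart_source F (pr x)))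
        (hpr.mdifferentiableAt (by simp))
    have h5 := congrArg (fun A : E →L[ℝ] F => A V) (h2.symm.trans (h3.trans h4))
    rw [← mfderiv_eq_fderiv]
    refine h5.trans ?_
    exact (congrArg (mfderiv (𝓡 d) 𝓘(ℝ, F) κ (pr x)) hV).trans (map_zero _)
  intro v i hi
  have h2 : w.extDerivAt x v = extDeriv (w.inChart x) y₀
      (fun j => mfderiv (𝓡 e) 𝓘(ℝ, E) (extChartAt (𝓡 e) x) x (v j)) := rfl
  rw [h2, hext]
  refine (extDeriv (η.inChart (pr x)) (P y₀)).map_coord_zero i ?_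
  exact (congrArg (fun V => fderiv ℝ P y₀ (mfderiv (𝓡 e) 𝓘(ℝ, E) (extChartAt (𝓡 e) x) x V))
    hi).trans hLV

end Regularity

/-- Zero is a regular value of the vertical coefficient of a contact form: at a critical zero of
the coefficient, the kernel of the differential of the projection, which is non-trivial for
reasons of dimension, would lie in the kernels of both `θ` and `dθ`. -/
theorem IsContactForm.differentialAt_ne_zero {n : ℕ} {B M : Type*} [TopologicalSpace B]
    [ChartedSpace (EuclideanSpace ℝ (Fin (2 * n))) B] [IsManifold (𝓡 (2 * n)) ∞ B]
    [TopologicalSpace M] [ChartedSpace (EuclideanSpace ℝ (Fin (2 * n + 1))) M]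
    [IsManifold (𝓡 (2 * n + 1)) ∞ M] {pr : M → B} {α θ : OneForm (2 * n + 1) M}
    {η : OneForm (2 * n) B} {φ : B → ℝ} (hθ : IsContactForm θ)
    (hpr : ContMDiff (𝓡 (2 * n + 1)) (𝓡 (2 * n)) ∞ pr)
    (hφ : ContMDiff (𝓡 (2 * n)) 𝓘(ℝ, ℝ) ∞ φ) (h : Decomposes pr α θ η φ) (x : M)
    (h0 : φ (pr x) = 0) : differentialAt (d := 2 * n) φ (pr x) ≠ 0 := by
  intro h1
  let A : EuclideanSpace ℝ (Fin (2 * n + 1)) →L[ℝ] EuclideanSpace ℝ (Fin (2 * n)) :=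
    mfderiv (𝓡 (2 * n + 1)) (𝓡 (2 * n)) pr x
  have hker : A.toLinearMap.ker ≠ ⊥ := LinearMap.ker_ne_bot_of_finrank_lt (by simp)
  obtain ⟨V, hV, hV0⟩ := Submodule.exists_mem_ne_zero_of_ne_bot hker
  have hθV : θ x V = 0 := by
    have h2 := congrArg (fun L => L V) (h x)
    have h3 : θ x V = η (pr x) (A V) + φ (pr x) * α x V := h2
    rw [h3, show A V = 0 from hV, h0, zero_mul, add_zero]
    exact map_zero (η (pr x))
  have hfin : FiniteDimensional ℝ (TangentSpace (𝓡 (2 * n + 1)) x) :=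
    inferInstanceAs (FiniteDimensional ℝ (EuclideanSpace ℝ (Fin (2 * n + 1))))
  refine hθ x (InKernel.eq_zero_of_card_eq_finrank (X := (V : TangentSpace (𝓡 (2 * n + 1)) x)) hV0
    ((InKernel.alternatingAt hθV).wedge
      ((h.inKernel_extDerivAt hpr hφ h0 h1 (V := V) hV).wedgePow n)) ?_)
  rw [finrank_euclideanSpace, Fintype.card_fin, Fintype.card_fin, add_comm]

/-! ### Pullbacks of 1-forms, and the generator of the circle action -/

section Pullback

variable {d e : ℕ} {B M : Type*} [TopologicalSpace B]
  [ChartedSpace (EuclideanSpace ℝ (Fin d)) B] [IsManifold (𝓡 d) ∞ B] [TopologicalSpace M]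
  [ChartedSpace (EuclideanSpace ℝ (Fin e)) M] [IsManifold (𝓡 e) ∞ M]

/-- The pullback of a smooth 1-form under a smooth map is smooth. -/
theorem contMDiffAt_pullback_oneForm (w : OneForm e M) {s : B → M} {b₀ : B}
    (hs : ContMDiffAt (𝓡 d) (𝓡 e) ∞ s b₀) :
    ContMDiffAt (𝓡 d) ((𝓡 d).prod 𝓘(ℝ, EuclideanSpace ℝ (Fin d) →L[ℝ] ℝ)) ∞
      (fun b => (⟨b, (w (s b)).comp (mfderiv (𝓡 d) (𝓡 e) s b)⟩ :
        Bundle.TotalSpace (EuclideanSpace ℝ (Fin d) →L[ℝ] ℝ)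
          (fun b : B => TangentSpace (𝓡 d) b →L[ℝ] ℝ))) b₀ := by
  refine (contMDiffAt_hom_bundle _).2 ⟨contMDiffAt_id, ?_⟩
  have h1 := ((contMDiffAt_hom_bundle _).1 (w.contMDiff (s b₀))).2.comp b₀ hs
  have h2 := hs.mfderiv_const (m := ∞) (by simp)
  refine (h1.clm_comp h2).congr_of_eventuallyEq ?_
  have h3 : ∀ᶠ b in 𝓝 b₀, s b ∈ (chartAt (EuclideanSpace ℝ (Fin e)) (s b₀)).source :=
    hs.continuousAt.eventually_mem (chart_source_mem_nhds _ _)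
  filter_upwards [h3] with b hb
  have h4 : s b ∈ (trivializationAt (EuclideanSpace ℝ (Fin e)) (TangentSpace (𝓡 e))
      (s b₀)).baseSet := hb
  ext v
  have h5 := Bundle.Trivialization.symmL_continuousLinearMapAt (R := ℝ)
    (trivializationAt (EuclideanSpace ℝ (Fin e)) (TangentSpace (𝓡 e)) (s b₀)) h4
    (mfderiv (𝓡 d) (𝓡 e) s b ((trivializationAt (EuclideanSpace ℝ (Fin d))
      (TangentSpace (𝓡 d)) b₀).symmL ℝ b v))
  exact (congrArg (fun u => (trivializationAt ℝ (fun _ : M => ℝ) (s b₀)).continuousLinearMapAt ℝ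
    (s b) (w (s b) u)) h5).symm

end Pullback

theorem tangentBundle_mk_eq {e : ℕ} {M : Type*} [TopologicalSpace M]
    [ChartedSpace (EuclideanSpace ℝ (Fin e)) M] {x y : M} (h : x = y) {u : TangentSpace (𝓡 e) x}
    {v : TangentSpace (𝓡 e) y} (huv : (u : EuclideanSpace ℝ (Fin e)) = v) :
    (⟨x, u⟩ : TangentBundle (𝓡 e) M) = ⟨y, v⟩ := by
  subst h
  exact congrArg (fun u : TangentSpace (𝓡 e) x => (⟨x, u⟩ : TangentBundle (𝓡 e) M)) huv

section Vertical

variable {e : ℕ} {M : Type*} [TopologicalSpace M]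
  [ChartedSpace (EuclideanSpace ℝ (Fin e)) M] [MulAction Circle M]

/-- The generator of the circle action: the velocity of `exp (it) • x` at `t = 0`, as a tangent
vector at `x`. The velocity lies in the tangent space at `exp 0 • x`, which is identified with that
at `x` through the model space. -/
def verticalVector (x : M) : TangentSpace (𝓡 e) x :=
  (mfderiv 𝓘(ℝ, ℝ) (𝓡 e) (fun t : ℝ => Circle.exp t • x) 0 (1 : ℝ) : EuclideanSpace ℝ (Fin e))

theorem IsConnectionForm.apply_verticalVector [IsManifold (𝓡 e) ∞ M] {α : OneForm e M}
    (hα : IsConnectionForm α) (x : M) : α x (verticalVector x) = 1 := by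
  have h : ∀ (z : M) (v : EuclideanSpace ℝ (Fin e)), z = x →
      (α z : EuclideanSpace ℝ (Fin e) →L[ℝ] ℝ) v = (α x : EuclideanSpace ℝ (Fin e) →L[ℝ] ℝ) v := by
    rintro _ v rfl
    rfl
  exact (h _ _ (by rw [Circle.exp_zero, one_smul])).symm.trans (hα.2 x)

theorem contMDiff_exp_smul
    (h : ContMDiff ((𝓡 1).prod (𝓡 e)) (𝓡 e) ∞ (fun q : Circle × M => q.1 • q.2)) :
    ContMDiff (𝓘(ℝ, ℝ).prod (𝓡 e)) (𝓡 e) ∞ (fun q : ℝ × M => Circle.exp q.1 • q.2) :=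
  h.comp ((contMDiff_circleExp.comp contMDiff_fst).prodMk contMDiff_snd)

theorem contMDiff_verticalVector [IsManifold (𝓡 e) ∞ M]
    (h : ContMDiff ((𝓡 1).prod (𝓡 e)) (𝓡 e) ∞ (fun q : Circle × M => q.1 • q.2)) :
    ContMDiff (𝓡 e) (𝓡 e).tangent ∞
      (fun x : M => (⟨x, verticalVector x⟩ : TangentBundle (𝓡 e) M)) := by
  have hE := contMDiff_exp_smul h
  set A : ℝ × M → M := fun q => Circle.exp q.1 • q.2
  -- the generator is the image of the vector field `(d/dt, 0)` on `ℝ × M` under the differential of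
  -- the action
  have h1 : ContMDiff (𝓡 e) (𝓘(ℝ, ℝ).tangent.prod (𝓡 e).tangent) ∞
      (fun x : M => ((⟨0, (1 : ℝ)⟩ : TangentBundle 𝓘(ℝ, ℝ) ℝ), (⟨x, 0⟩ : TangentBundle (𝓡 e) M))) :=
    contMDiff_const.prodMk (Bundle.contMDiff_zeroSection ℝ (TangentSpace (𝓡 e) : M → Type))
  have h2 := (contMDiff_equivTangentBundleProd_symm (n := ∞)).comp h1
  have h3 := (hE.contMDiff_tangentMap (m := ∞) (by simp)).comp h2
  refine h3.congr fun x => ?_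
  refine tangentBundle_mk_eq (by simp [A, equivTangentBundleProd]) ?_
  have h4 : mfderiv 𝓘(ℝ, ℝ) (𝓡 e) (A ∘ fun t : ℝ => (t, x)) 0 =
      (mfderiv (𝓘(ℝ, ℝ).prod (𝓡 e)) (𝓡 e) A (0, x)).comp
        (mfderiv 𝓘(ℝ, ℝ) (𝓘(ℝ, ℝ).prod (𝓡 e)) (fun t : ℝ => (t, x)) 0) :=
    mfderiv_comp 0 (hE.mdifferentiableAt (by simp))
      (mdifferentiableAt_id.prodMk mdifferentiableAt_const)
  rw [mfderiv_prod_left] at h4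
  exact congrArg (fun L : ℝ →L[ℝ] EuclideanSpace ℝ (Fin e) => L 1) h4

/-- The generator of the action is invariant, because the circle is commutative. -/
theorem verticalVector_smul
    (h : ContMDiff ((𝓡 1).prod (𝓡 e)) (𝓡 e) ∞ (fun q : Circle × M => q.1 • q.2))
    (z : Circle) (x : M) : (verticalVector (z • x) : TangentSpace (𝓡 e) (z • x)) =
      mfderiv (𝓡 e) (𝓡 e) (fun y : M => z • y) x (verticalVector x) := by
  have hz : ContMDiff (𝓡 e) (𝓡 e) ∞ (fun y : M => z • y) :=
    h.comp (contMDiff_const.prodMk contMDiff_id)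
  have hc : ContMDiff 𝓘(ℝ, ℝ) (𝓡 e) ∞ (fun t : ℝ => Circle.exp t • x) :=
    (contMDiff_exp_smul h).comp (contMDiff_id.prodMk contMDiff_const)
  have h1 : mfderiv 𝓘(ℝ, ℝ) (𝓡 e) ((fun y : M => z • y) ∘ fun t : ℝ => Circle.exp t • x) 0 =
      (mfderiv (𝓡 e) (𝓡 e) (fun y : M => z • y) (Circle.exp 0 • x)).comp
        (mfderiv 𝓘(ℝ, ℝ) (𝓡 e) (fun t : ℝ => Circle.exp t • x) 0) :=
    mfderiv_comp 0 (hz.mdifferentiableAt (by simp)) (hc.mdifferentiableAt (by simp))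
  have h2 : (fun t : ℝ => Circle.exp t • z • x) =
      (fun y : M => z • y) ∘ fun t : ℝ => Circle.exp t • x := by
    funext t
    exact smul_comm _ _ _
  have h3 : ∀ (y : M) (v : EuclideanSpace ℝ (Fin e)), y = x →
      (mfderiv (𝓡 e) (𝓡 e) (fun y : M => z • y) y :
        EuclideanSpace ℝ (Fin e) →L[ℝ] EuclideanSpace ℝ (Fin e)) v =
      (mfderiv (𝓡 e) (𝓡 e) (fun y : M => z • y) x :
        EuclideanSpace ℝ (Fin e) →L[ℝ] EuclideanSpace ℝ (Fin e)) v := by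
    rintro _ v rfl
    rfl
  have h4 : ∀ f g : ℝ → M, f = g →
      (mfderiv 𝓘(ℝ, ℝ) (𝓡 e) f 0 : ℝ →L[ℝ] EuclideanSpace ℝ (Fin e)) 1 =
      (mfderiv 𝓘(ℝ, ℝ) (𝓡 e) g 0 : ℝ →L[ℝ] EuclideanSpace ℝ (Fin e)) 1 := by
    rintro _ _ rfl
    rfl
  exact (h4 _ _ h2).trans ((congrArg (fun L : ℝ →L[ℝ] EuclideanSpace ℝ (Fin e) => L 1) h1).trans
    (h3 _ _ (by rw [Circle.exp_zero, one_smul])))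

/-- An invariant form takes the same value on the generator along each orbit. -/
theorem InvariantForm.apply_verticalVector_smul [IsManifold (𝓡 e) ∞ M]
    (h : ContMDiff ((𝓡 1).prod (𝓡 e)) (𝓡 e) ∞ (fun q : Circle × M => q.1 • q.2))
    {w : OneForm e M} (hw : InvariantForm w) (z : Circle) (x : M) :
    w (z • x) (verticalVector (z • x)) = w x (verticalVector x) := by
  rw [verticalVector_smul h z x]
  exact congrArg (fun L => L (verticalVector x)) (hw z x)

theorem contMDiff_apply_verticalVector [IsManifold (𝓡 e) ∞ M]
    (h : ContMDiff ((𝓡 1).prod (𝓡 e)) (𝓡 e) ∞ (fun q : Circle × M => q.1 • q.2))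
    (w : OneForm e M) : ContMDiff (𝓡 e) 𝓘(ℝ, ℝ) ∞ (fun x => w x (verticalVector x)) := by
  intro x
  have h1 := ContMDiffAt.clm_bundle_apply (E₂ := fun _ : M => ℝ) (w.contMDiff x)
    (contMDiff_verticalVector h x)
  exact (Bundle.contMDiffAt_totalSpace.1 h1).2

end Vertical

/-! ### Decomposition of invariant forms -/

section Bundle

variable {d e : ℕ} {B M : Type*} [TopologicalSpace B]
  [ChartedSpace (EuclideanSpace ℝ (Fin d)) B] [TopologicalSpace M]
  [ChartedSpace (EuclideanSpace ℝ (Fin e)) M] [MulAction Circle M] {pr : M → B}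

namespace IsPrincipalCircleBundle

/-- The fibres are single orbits. -/
theorem exists_smul_eq (hpr : IsPrincipalCircleBundle (d := d) (e := e) pr) {x y : M}
    (h : pr x = pr y) : ∃ z : Circle, z • x = y := by
  obtain ⟨U, -, hU, τ, hsrc, -, -, -, hτ1, hτ2⟩ := hpr.exists_trivialization (pr y)
  have hy : y ∈ τ.source := by rw [hsrc]; exact hU
  have hx : x ∈ τ.source := by rw [hsrc, mem_preimage, h]; exact hU
  refine ⟨(τ y).2 * ((τ x).2)⁻¹, τ.injOn ?_ hy ?_⟩
  · rw [hsrc, mem_preimage, hpr.proj_smul, h]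
    exact hU
  · rw [hτ2 x hx, inv_mul_cancel_right, h, ← hτ1 y hy]

/-- There are smooth local sections near every point of the base. -/
theorem exists_localSection (hpr : IsPrincipalCircleBundle (d := d) (e := e) pr) (b : B) :
    ∃ s : B → M, ∀ᶠ b' in 𝓝 b, ContMDiffAt (𝓡 d) (𝓡 e) ∞ s b' ∧ pr (s b') = b' := by
  obtain ⟨U, hUo, hU, τ, hsrc, htgt, -, hτs, hτ1, -⟩ := hpr.exists_trivialization b
  refine ⟨fun b' => τ.symm (b', 1), ?_⟩
  filter_upwards [hUo.mem_nhds hU] with b' hb'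
  have hmem : (b', (1 : Circle)) ∈ τ.target := by rw [htgt]; exact ⟨hb', mem_univ _⟩
  constructor
  · have h1 := hτs.contMDiffAt (τ.open_target.mem_nhds hmem)
    exact h1.comp b' (contMDiffAt_id.prodMk contMDiffAt_const)
  · rw [← hτ1 _ (τ.map_target hmem), τ.right_inv hmem]

theorem contMDiff_const_smul (hpr : IsPrincipalCircleBundle (d := d) (e := e) pr) (z : Circle) :
    ContMDiff (𝓡 e) (𝓡 e) ∞ (fun y : M => z • y) :=
  hpr.contMDiff_smul.comp (contMDiff_const.prodMk contMDiff_id)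

theorem surjective (hpr : IsPrincipalCircleBundle (d := d) (e := e) pr) :
    Function.Surjective pr := fun b => by
  obtain ⟨s, hs⟩ := hpr.exists_localSection b
  exact ⟨s b, hs.self_of_nhds.2⟩

theorem mfderiv_verticalVector (hpr : IsPrincipalCircleBundle (d := d) (e := e) pr) (x : M) :
    mfderiv (𝓡 e) (𝓡 d) pr x (verticalVector x) = 0 := by
  have hc : ContMDiff 𝓘(ℝ, ℝ) (𝓡 e) ∞ (fun t : ℝ => Circle.exp t • x) :=
    (contMDiff_exp_smul hpr.contMDiff_smul).comp (contMDiff_id.prodMk contMDiff_const)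
  have h1 : mfderiv 𝓘(ℝ, ℝ) (𝓡 d) (pr ∘ fun t : ℝ => Circle.exp t • x) 0 =
      (mfderiv (𝓡 e) (𝓡 d) pr (Circle.exp 0 • x)).comp
        (mfderiv 𝓘(ℝ, ℝ) (𝓡 e) (fun t : ℝ => Circle.exp t • x) 0) :=
    mfderiv_comp 0 (hpr.contMDiff_proj.mdifferentiableAt (by simp))
      (hc.mdifferentiableAt (by simp))
  have h2 : (mfderiv 𝓘(ℝ, ℝ) (𝓡 d) (pr ∘ fun t : ℝ => Circle.exp t • x) 0 :
      ℝ →L[ℝ] EuclideanSpace ℝ (Fin d)) = 0 := by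
    rw [show (pr ∘ fun t : ℝ => Circle.exp t • x) = fun _ => pr x from
      funext fun t => hpr.proj_smul _ _]
    exact mfderiv_const
  have h3 : ∀ (y : M) (v : EuclideanSpace ℝ (Fin e)), y = x →
      (mfderiv (𝓡 e) (𝓡 d) pr x : EuclideanSpace ℝ (Fin e) →L[ℝ] EuclideanSpace ℝ (Fin d)) v =
      (mfderiv (𝓡 e) (𝓡 d) pr y : EuclideanSpace ℝ (Fin e) →L[ℝ] EuclideanSpace ℝ (Fin d)) v := by
    rintro _ v rfl
    rfl
  have h4 : (mfderiv (𝓡 e) (𝓡 d) pr (Circle.exp 0 • x) :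
      EuclideanSpace ℝ (Fin e) →L[ℝ] EuclideanSpace ℝ (Fin d)) (verticalVector x) = 0 :=
    congrArg (fun L : ℝ →L[ℝ] EuclideanSpace ℝ (Fin d) => L 1) (h1.symm.trans h2)
  exact (h3 (Circle.exp 0 • x) (verticalVector x) (by rw [Circle.exp_zero, one_smul])).trans h4

/-- The differential of a local section is a right inverse of the differential of the
projection. -/
theorem mfderiv_comp_mfderiv_section (hpr : IsPrincipalCircleBundle (d := d) (e := e) pr)
    {s : B → M} {b : B} (hs : ContMDiffAt (𝓡 d) (𝓡 e) ∞ s b) (hps : ∀ᶠ b' in 𝓝 b, pr (s b') = b')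
    (v : EuclideanSpace ℝ (Fin d)) :
    (mfderiv (𝓡 e) (𝓡 d) pr (s b) : EuclideanSpace ℝ (Fin e) →L[ℝ] EuclideanSpace ℝ (Fin d))
      (mfderiv (𝓡 d) (𝓡 e) s b v) = v := by
  have h1 : mfderiv (𝓡 d) (𝓡 d) (pr ∘ s) b =
      (mfderiv (𝓡 e) (𝓡 d) pr (s b)).comp (mfderiv (𝓡 d) (𝓡 e) s b) :=
    mfderiv_comp b (hpr.contMDiff_proj.mdifferentiableAt (by simp))
      (hs.mdifferentiableAt (by simp))
  have h2 : (mfderiv (𝓡 d) (𝓡 d) (pr ∘ s) b :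
      EuclideanSpace ℝ (Fin d) →L[ℝ] EuclideanSpace ℝ (Fin d)) = mfderiv (𝓡 d) (𝓡 d) id b :=
    Filter.EventuallyEq.mfderiv_eq hps
  have h3 : (mfderiv (𝓡 d) (𝓡 d) (id : B → B) b :
      EuclideanSpace ℝ (Fin d) →L[ℝ] EuclideanSpace ℝ (Fin d)) =
      ContinuousLinearMap.id ℝ (EuclideanSpace ℝ (Fin d)) := mfderiv_id
  exact congrArg (fun L : EuclideanSpace ℝ (Fin d) →L[ℝ] EuclideanSpace ℝ (Fin d) => L v)
    (h1.symm.trans (h2.trans h3))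

end IsPrincipalCircleBundle

end Bundle

section VerticalCoeffDef

variable {d : ℕ} {B M : Type*} [TopologicalSpace M]
  [ChartedSpace (EuclideanSpace ℝ (Fin (d + 1))) M] [IsManifold (𝓡 (d + 1)) ∞ M]
  [MulAction Circle M] {pr : M → B}

/-- The vertical coefficient of an invariant 1-form `w` on a principal circle bundle, as a
function on the base: the value of `w` on the generator of the action, at some point of the
fibre. -/
def verticalCoeff (pr : M → B) (hpr : Function.Surjective pr) (w : OneForm (d + 1) M) (b : B) :
    ℝ :=
  w (Function.surjInv hpr b) (verticalVector (Function.surjInv hpr b))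

theorem verticalCoeff_sum_smul (hpr : Function.Surjective pr) {ι : Type*} [Fintype ι]
    (c : ι → ℝ) (w : ι → OneForm (d + 1) M) (b : B) :
    verticalCoeff pr hpr (∑ i, c i • w i) b = ∑ i, c i * verticalCoeff pr hpr (w i) b := by
  set x := Function.surjInv hpr b with hx
  have h1 : (∑ i, c i • w i : OneForm (d + 1) M) x = ∑ i, c i • w i x := by
    have := congrFun (map_sum (ContMDiffSection.coeAddHom (𝓡 (d + 1))
      (EuclideanSpace ℝ (Fin (d + 1)) →L[ℝ] ℝ) ∞
      (fun x : M => TangentSpace (𝓡 (d + 1)) x →L[ℝ] ℝ)) (fun i => c i • w i) Finset.univ) x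
    refine this.trans ?_
    rw [Finset.sum_apply]
    rfl
  rw [verticalCoeff, ← hx, h1, sum_apply]
  rfl

end VerticalCoeffDef

section VerticalCoeff

variable {d : ℕ} {B M : Type*} [TopologicalSpace B]
  [ChartedSpace (EuclideanSpace ℝ (Fin d)) B] [TopologicalSpace M]
  [ChartedSpace (EuclideanSpace ℝ (Fin (d + 1))) M] [IsManifold (𝓡 (d + 1)) ∞ M]
  [MulAction Circle M] {pr : M → B}

/-- The kernel of the differential of the projection is spanned by the generator of the action. -/
theorem IsPrincipalCircleBundle.exists_eq_smul_verticalVector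
    (hpr : IsPrincipalCircleBundle (d := d) (e := d + 1) pr) {α : OneForm (d + 1) M}
    (hα : IsConnectionForm α) {s : B → M} {b : B} (hs : ContMDiffAt (𝓡 d) (𝓡 (d + 1)) ∞ s b)
    (hps : ∀ᶠ b' in 𝓝 b, pr (s b') = b') {u : EuclideanSpace ℝ (Fin (d + 1))}
    (hu : (mfderiv (𝓡 (d + 1)) (𝓡 d) pr (s b) :
      EuclideanSpace ℝ (Fin (d + 1)) →L[ℝ] EuclideanSpace ℝ (Fin d)) u = 0) :
    ∃ c : ℝ, c • (verticalVector (s b) : EuclideanSpace ℝ (Fin (d + 1))) = u := by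
  let A : EuclideanSpace ℝ (Fin (d + 1)) →L[ℝ] EuclideanSpace ℝ (Fin d) :=
    mfderiv (𝓡 (d + 1)) (𝓡 d) pr (s b)
  let X : EuclideanSpace ℝ (Fin (d + 1)) := verticalVector (s b)
  have hX : X ∈ A.toLinearMap.ker := hpr.mfderiv_verticalVector (s b)
  have hX0 : X ≠ 0 := by
    intro h0
    have h1 : α (s b) (verticalVector (s b)) = 0 :=
      (congrArg (α (s b) : EuclideanSpace ℝ (Fin (d + 1)) →L[ℝ] ℝ) h0).trans (map_zero _)
    rw [hα.apply_verticalVector] at h1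
    exact one_ne_zero h1
  have hsurj : A.toLinearMap.range = ⊤ := LinearMap.range_eq_top.2 fun v =>
    ⟨_, hpr.mfderiv_comp_mfderiv_section hs hps v⟩
  have hdim := A.toLinearMap.finrank_range_add_finrank_ker
  rw [hsurj, finrank_top, finrank_euclideanSpace, finrank_euclideanSpace, Fintype.card_fin,
    Fintype.card_fin] at hdim
  have hker : Module.finrank ℝ A.toLinearMap.ker = 1 := Nat.add_left_cancel hdim
  obtain ⟨c, hc⟩ := (finrank_eq_one_iff_of_nonzero' (⟨X, hX⟩ : A.toLinearMap.ker)
    (fun h => hX0 (congrArg Subtype.val h))).1 hker ⟨u, hu⟩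
  exact ⟨c, congrArg Subtype.val hc⟩

theorem verticalCoeff_apply (hpr : IsPrincipalCircleBundle (d := d) (e := d + 1) pr)
    {w : OneForm (d + 1) M} (hw : InvariantForm w) (x : M) :
    verticalCoeff pr hpr.surjective w (pr x) = w x (verticalVector x) := by
  obtain ⟨z, hz⟩ := hpr.exists_smul_eq (Function.surjInv_eq hpr.surjective (pr x))
  rw [verticalCoeff, ← hw.apply_verticalVector_smul hpr.contMDiff_smul z, hz]

theorem contMDiff_verticalCoeff (hpr : IsPrincipalCircleBundle (d := d) (e := d + 1) pr)
    {w : OneForm (d + 1) M} (hw : InvariantForm w) :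
    ContMDiff (𝓡 d) 𝓘(ℝ, ℝ) ∞ (verticalCoeff pr hpr.surjective w) := by
  intro b
  obtain ⟨s, hs⟩ := hpr.exists_localSection b
  refine ((contMDiff_apply_verticalVector hpr.contMDiff_smul w).contMDiffAt.comp b
    hs.self_of_nhds.1).congr_of_eventuallyEq ?_
  filter_upwards [hs] with b' hb'
  rw [Function.comp_apply, ← verticalCoeff_apply hpr hw, hb'.2]

/-- The horizontal part `w - φ α` of an invariant form is the pullback under `pr` of its pullback
under a local section. -/
theorem IsPrincipalCircleBundle.eq_pullback_section
    (hpr : IsPrincipalCircleBundle (d := d) (e := d + 1) pr) {α w : OneForm (d + 1) M}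
    (hα : IsConnectionForm α) (hw : InvariantForm w) {s : B → M} {b : B}
    (hs : ContMDiffAt (𝓡 d) (𝓡 (d + 1)) ∞ s b) (hps : ∀ᶠ b' in 𝓝 b, pr (s b') = b')
    {x : M} (hx : pr x = b) (u : EuclideanSpace ℝ (Fin (d + 1))) :
    w x u = (w (s b) (mfderiv (𝓡 d) (𝓡 (d + 1)) s b (mfderiv (𝓡 (d + 1)) (𝓡 d) pr x u)) -
      verticalCoeff pr hpr.surjective w b *
        α (s b) (mfderiv (𝓡 d) (𝓡 (d + 1)) s b (mfderiv (𝓡 (d + 1)) (𝓡 d) pr x u))) +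
      verticalCoeff pr hpr.surjective w b * α x u := by
  obtain ⟨z, rfl⟩ := hpr.exists_smul_eq (hps.self_of_nhds.trans hx.symm)
  let F := EuclideanSpace ℝ (Fin d)
  let E := EuclideanSpace ℝ (Fin (d + 1))
  -- a translate of the section passes through the given point of the fibre
  let σ : B → M := fun b' => z • s b'
  have hz := hpr.contMDiff_const_smul z
  have hσ : ContMDiffAt (𝓡 d) (𝓡 (d + 1)) ∞ σ b := hz.contMDiffAt.comp b hs
  have hpσ : ∀ᶠ b' in 𝓝 b, pr (σ b') = b' := by
    filter_upwards [hps] with b' hb'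
    exact (hpr.proj_smul _ _).trans hb'
  have hdσ : mfderiv (𝓡 d) (𝓡 (d + 1)) σ b =
      (mfderiv (𝓡 (d + 1)) (𝓡 (d + 1)) (fun y : M => z • y) (s b)).comp
        (mfderiv (𝓡 d) (𝓡 (d + 1)) s b) :=
    mfderiv_comp b (hz.mdifferentiableAt (by simp)) (hs.mdifferentiableAt (by simp))
  let v : F := (mfderiv (𝓡 (d + 1)) (𝓡 d) pr (z • s b) : E →L[ℝ] F) u
  let u' : E := (mfderiv (𝓡 d) (𝓡 (d + 1)) σ b : F →L[ℝ] E) v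
  have hu' : ∀ θ : OneForm (d + 1) M, InvariantForm θ → (θ (z • s b) : E →L[ℝ] ℝ) u' =
      θ (s b) (mfderiv (𝓡 d) (𝓡 (d + 1)) s b v) := fun θ hθ =>
    (congrArg (fun L : F →L[ℝ] E => (θ (z • s b) : E →L[ℝ] ℝ) (L v)) hdσ).trans
      (congrArg (fun L : E →L[ℝ] ℝ => L (mfderiv (𝓡 d) (𝓡 (d + 1)) s b v)) (hθ z (s b)))
  -- `u - u'` is vertical, and `w - φ α` vanishes on vertical vectors
  obtain ⟨c, hc⟩ := hpr.exists_eq_smul_verticalVector hα hσ hpσ (u := u - u')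
    ((map_sub (mfderiv (𝓡 (d + 1)) (𝓡 d) pr (σ b) : E →L[ℝ] F) u u').trans
      (sub_eq_zero.2 (hpr.mfderiv_comp_mfderiv_section hσ hpσ v).symm))
  have hdec : ∀ θ : OneForm (d + 1) M, InvariantForm θ → (θ (z • s b) : E →L[ℝ] ℝ) u =
      θ (s b) (mfderiv (𝓡 d) (𝓡 (d + 1)) s b v) +
        c * θ (z • s b) (verticalVector (z • s b)) := by
    intro θ hθ
    rw [← hu' θ hθ, ← sub_eq_iff_eq_add']
    exact ((map_sub (θ (z • s b) : E →L[ℝ] ℝ) u u').symm.trans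
      (congrArg (θ (z • s b) : E →L[ℝ] ℝ) hc.symm)).trans
      (map_smul (θ (z • s b) : E →L[ℝ] ℝ) c _)
  have h1 := hdec w hw
  have h2 := hdec α hα.1
  rw [hα.apply_verticalVector, mul_one] at h2
  rw [← verticalCoeff_apply hpr hw, hx] at h1
  have h3 : ∀ p q r p' q' a : ℝ, p = q + c * a → p' = q' + c → r = a →
      p = (q - r * q') + r * p' := by
    rintro _ _ _ _ _ _ rfl rfl rfl
    ring
  exact h3 _ _ _ _ _ _ h1 h2 rfl

section Decomposition

variable [IsManifold (𝓡 d) ∞ B]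

/-- In any decomposition of `w`, the function on the base is the vertical coefficient. -/
theorem Decomposes.eq_apply_verticalVector
    (hpr : IsPrincipalCircleBundle (d := d) (e := d + 1) pr) {α w : OneForm (d + 1) M}
    (hα : IsConnectionForm α) {η : OneForm d B} {φ : B → ℝ} (h : Decomposes pr α w η φ) (x : M) :
    φ (pr x) = w x (verticalVector x) := by
  have h1 : w x (verticalVector x) =
      η (pr x) (mfderiv (𝓡 (d + 1)) (𝓡 d) pr x (verticalVector x)) +
        φ (pr x) * α x (verticalVector x) :=
    congrArg (fun L => L (verticalVector x)) (h x)
  rw [h1, hpr.mfderiv_verticalVector, hα.apply_verticalVector, mul_one]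
  exact (zero_add (φ (pr x))).symm.trans
    (congrArg (· + φ (pr x)) (map_zero (η (pr x))).symm)

/-- Every invariant 1-form decomposes as `pr^*(η) + pr^*(φ) α`, where `φ` is its vertical
coefficient. -/
theorem IsPrincipalCircleBundle.exists_decomposes
    (hpr : IsPrincipalCircleBundle (d := d) (e := d + 1) pr) {α w : OneForm (d + 1) M}
    (hα : IsConnectionForm α) (hw : InvariantForm w) :
    ∃ η : OneForm d B, Decomposes pr α w η (verticalCoeff pr hpr.surjective w) := by
  choose s hs using hpr.exists_localSection
  set φ := verticalCoeff pr hpr.surjective w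
  -- the formula for the horizontal part along the local section `s b₀`
  let H : (b₀ b : B) → (TangentSpace (𝓡 d) b →L[ℝ] ℝ) := fun b₀ b =>
    (w (s b₀ b)).comp (mfderiv (𝓡 d) (𝓡 (d + 1)) (s b₀) b) -
      φ b • (α (s b₀ b)).comp (mfderiv (𝓡 d) (𝓡 (d + 1)) (s b₀) b)
  have hH : ∀ b₀, ∀ᶠ b in 𝓝 b₀, ∀ x, pr x = b → ∀ u : EuclideanSpace ℝ (Fin (d + 1)),
      w x u = H b₀ b (mfderiv (𝓡 (d + 1)) (𝓡 d) pr x u) + φ b * α x u := by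
    intro b₀
    filter_upwards [(hs b₀).eventually_nhds] with b hb x hx u
    exact hpr.eq_pullback_section hα hw hb.self_of_nhds.1 (hb.mono fun _ h => h.2) hx u
  -- the formulas along different sections agree, since the differential of `pr` is surjective
  have hHeq : ∀ b₀, ∀ᶠ b in 𝓝 b₀, H b b = H b₀ b := by
    intro b₀
    filter_upwards [hH b₀] with b hb
    ext v
    obtain ⟨hsb, hpb⟩ := (hs b).self_of_nhds
    have h1 := hpr.mfderiv_comp_mfderiv_section hsb ((hs b).mono fun _ h => h.2) v
    have h2 := hb (s b b) hpb (mfderiv (𝓡 d) (𝓡 (d + 1)) (s b) b v)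
    have h3 := (hH b).self_of_nhds (s b b) hpb (mfderiv (𝓡 d) (𝓡 (d + 1)) (s b) b v)
    have h4 := add_right_cancel (h3.symm.trans h2)
    exact ((congrArg (H b b) h1).symm.trans h4).trans (congrArg (H b₀ b) h1)
  have hHs : ∀ b₀, ContMDiffAt (𝓡 d) ((𝓡 d).prod 𝓘(ℝ, EuclideanSpace ℝ (Fin d) →L[ℝ] ℝ)) ∞
      (fun b => (⟨b, H b₀ b⟩ : Bundle.TotalSpace (EuclideanSpace ℝ (Fin d) →L[ℝ] ℝ)
          (fun b : B => TangentSpace (𝓡 d) b →L[ℝ] ℝ))) b₀ := by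
    intro b₀
    have hsb := (hs b₀).self_of_nhds.1
    exact (contMDiffAt_pullback_oneForm w hsb).sub_section
      (ContMDiffAt.smul_section (contMDiff_verticalCoeff hpr hw).contMDiffAt
        (contMDiffAt_pullback_oneForm α hsb))
  refine ⟨⟨fun b => H b b, fun b₀ => (hHs b₀).congr_of_eventuallyEq ?_⟩, fun x => ?_⟩
  · filter_upwards [hHeq b₀] with b hb
    rw [hb]
  · ext u
    exact (hH (pr x)).self_of_nhds x rfl u

/-- The singular set is the zero set of the vertical coefficient. -/
theorem singularSet_eq (hpr : IsPrincipalCircleBundle (d := d) (e := d + 1) pr)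
    {α w : OneForm (d + 1) M} (hα : IsConnectionForm α) (hw : InvariantForm w) :
    singularSet (d := d) pr α w = {b | verticalCoeff pr hpr.surjective w b = 0} := by
  ext b
  constructor
  · rintro ⟨η, φ, -, hdec, hb⟩
    obtain ⟨x, rfl⟩ := hpr.surjective b
    exact ((verticalCoeff_apply hpr hw x).trans (hdec.eq_apply_verticalVector hpr hα x).symm).trans
      hb
  · intro hb
    obtain ⟨η, hη⟩ := hpr.exists_decomposes hα hw
    exact ⟨η, _, contMDiff_verticalCoeff hpr hw, hη, hb⟩

end Decomposition

end VerticalCoeff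

/-! ### Regular systems of functions -/

/-- Every non-zero vector has a positive multiple on the unit sphere. -/
theorem exists_smul_sum_sq_eq_one {ι : Type*} [Fintype ι] {c : ι → ℝ} (hc : c ≠ 0) :
    ∃ k : ℝ, 0 < k ∧ ∑ i, (k • c) i ^ 2 = 1 := by
  have hpos : 0 < ∑ i, c i ^ 2 := by
    obtain ⟨i, hi⟩ := Function.ne_iff.1 hc
    exact Finset.sum_pos' (fun i _ => sq_nonneg _) ⟨i, Finset.mem_univ i, sq_pos_iff.2 hi⟩
  refine ⟨(√(∑ i, c i ^ 2))⁻¹, by positivity, ?_⟩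
  simp only [Pi.smul_apply, smul_eq_mul, mul_pow, ← Finset.mul_sum]
  rw [inv_pow, Real.sq_sqrt hpos.le, inv_mul_cancel₀ hpos.ne']

section RegularSystem

variable {d : ℕ} {X : Type*} [TopologicalSpace X] [ChartedSpace (EuclideanSpace ℝ (Fin d)) X]
  {ι : Type} [Fintype ι]

/-- Zero is a regular value of every non-trivial linear combination of the functions `φ i`. -/
def IsRegularSystem (φ : ι → X → ℝ) : Prop :=
  ∀ c : ι → ℝ, c ≠ 0 → ∀ x, ∑ i, c i * φ i x = 0 →
    ∑ i, c i • differentialAt (d := d) (φ i) x ≠ 0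

theorem differentialAt_sum_mul {φ : ι → X → ℝ} (hφ : ∀ i, ContMDiff (𝓡 d) 𝓘(ℝ, ℝ) ∞ (φ i))
    (c : ι → ℝ) (x : X) : differentialAt (d := d) (fun y => ∑ i, c i * φ i y) x =
      ∑ i, c i • differentialAt (d := d) (φ i) x := by
  have h : ∀ i, HasMFDerivAt (𝓡 d) 𝓘(ℝ, ℝ) (φ i) x (differentialAt (d := d) (φ i) x) := fun i =>
    ((hφ i).mdifferentiableAt (by simp)).hasMFDerivAt
  have h1 : ∀ i ∈ Finset.univ, HasMFDerivAt (𝓡 d) 𝓘(ℝ, ℝ) (c i • φ i) x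
      (c i • differentialAt (d := d) (φ i) x) := fun i _ => (h i).const_smul (c i)
  have h2 := HasMFDerivAt.sum h1
  have h3 : (∑ i, c i • φ i) = fun y => ∑ i, c i * φ i y := by
    funext y
    simp
  rw [h3] at h2
  exact h2.mfderiv

theorem contMDiff_sum_mul {φ : ι → X → ℝ} (hφ : ∀ i, ContMDiff (𝓡 d) 𝓘(ℝ, ℝ) ∞ (φ i))
    (c : ι → ℝ) : ContMDiff (𝓡 d) 𝓘(ℝ, ℝ) ∞ (fun y => ∑ i, c i * φ i y) :=
  contMDiff_finsetSum fun i _ => contMDiff_const.mul (hφ i)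

theorem IsRegularSystem.isRegularPencil {φ : ι → X → ℝ} (hreg : IsRegularSystem (d := d) φ)
    (hφ : ∀ i, ContMDiff (𝓡 d) 𝓘(ℝ, ℝ) ∞ (φ i)) {c c' : ι → ℝ}
    (hc : LinearIndependent ℝ ![c, c']) :
    IsRegularPencil (d := d) (fun x => ∑ i, c i * φ i x) (fun x => ∑ i, c' i * φ i x) := by
  intro x a b h0 h1
  rw [differentialAt_sum_mul hφ, differentialAt_sum_mul hφ] at h1
  refine LinearIndependent.pair_iff.1 hc a b ?_
  by_contra hne
  refine hreg _ hne x ?_ ?_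
  · rw [← h0, Finset.mul_sum, Finset.mul_sum, ← Finset.sum_add_distrib]
    refine Finset.sum_congr rfl fun i _ => ?_
    simp only [Pi.add_apply, Pi.smul_apply, smul_eq_mul]
    ring
  · rw [← h1, Finset.smul_sum, Finset.smul_sum, ← Finset.sum_add_distrib]
    refine Finset.sum_congr rfl fun i _ => ?_
    simp only [Pi.add_apply, Pi.smul_apply, smul_eq_mul, add_smul, mul_smul]

theorem areIsotopic_refl (S : Set X) : AreIsotopic (d := d) S S :=
  ⟨fun _ => Diffeomorph.refl _ _ _, contMDiff_snd.contMDiffOn, fun _ => rfl, by simp⟩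

/-- The zero sets of any two non-trivial linear combinations of a regular system on a compact
manifold are isotopic. -/
theorem IsRegularSystem.areIsotopic [IsManifold (𝓡 d) ∞ X] [T2Space X] [CompactSpace X]
    {φ : ι → X → ℝ} (hreg : IsRegularSystem (d := d) φ)
    (hφ : ∀ i, ContMDiff (𝓡 d) 𝓘(ℝ, ℝ) ∞ (φ i)) {c c' : ι → ℝ} (hc : c ≠ 0) (hc' : c' ≠ 0) :
    AreIsotopic (d := d) {x | ∑ i, c i * φ i x = 0} {x | ∑ i, c' i * φ i x = 0} := by
  by_cases hli : LinearIndependent ℝ ![c, c']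
  · -- at the angle `π / 2` the rotation of the pencil has moved `c` to `c'`
    have h := areIsotopic_zeroSets_of_isRegularPencil (contMDiff_sum_mul hφ c)
      (contMDiff_sum_mul hφ c') (hreg.isRegularPencil hφ hli) (Real.pi / 2)
    simpa only [Real.cos_pi_div_two, Real.sin_pi_div_two, zero_mul, one_mul, zero_add] using h
  · rw [LinearIndependent.pair_iff' hc] at hli
    push Not at hli
    obtain ⟨k, rfl⟩ := hli
    have hk : k ≠ 0 := by
      rintro rfl
      exact hc' (zero_smul _ _)
    have hset : {x | ∑ i, (k • c) i * φ i x = 0} = {x | ∑ i, c i * φ i x = 0} := by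
      ext x
      simp only [Pi.smul_apply, smul_eq_mul, mul_assoc, ← Finset.mul_sum, mem_ofPred_eq,
        mul_eq_zero, hk, false_or]
    rw [hset]
    exact areIsotopic_refl _

end RegularSystem

/-- A linear functional in at least two variables vanishes somewhere on the unit sphere. -/
theorem exists_sum_sq_eq_one_sum_mul_eq_zero {p : ℕ} (hp : 1 ≤ p) (a : Fin (p + 1) → ℝ) :
    ∃ c : Fin (p + 1) → ℝ, ∑ i, c i ^ 2 = 1 ∧ ∑ i, c i * a i = 0 := by
  let L : (Fin (p + 1) → ℝ) →ₗ[ℝ] ℝ := ∑ i, (a i) • LinearMap.proj i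
  have hL : ∀ c, L c = ∑ i, c i * a i := fun c => by
    simp [L, mul_comm]
  obtain ⟨c, hc, hc0⟩ := Submodule.exists_mem_ne_zero_of_ne_bot
    (LinearMap.ker_ne_bot_of_finrank_lt (f := L) (by simp; omega))
  obtain ⟨k, -, hk⟩ := exists_smul_sum_sq_eq_one hc0
  refine ⟨k • c, hk, ?_⟩
  rw [← hL, map_smul, LinearMap.mem_ker.1 hc, smul_zero]

/-! ### The singular sets of a contact sphere -/

section ContactSphereFamily

variable {n p : ℕ} {B M : Type*}
  [TopologicalSpace B] [ChartedSpace (EuclideanSpace ℝ (Fin (2 * n))) B]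
  [TopologicalSpace M] [ChartedSpace (EuclideanSpace ℝ (Fin (2 * n + 1))) M]
  [IsManifold (𝓡 (2 * n + 1)) ∞ M] [MulAction Circle M] {pr : M → B}
  {α : OneForm (2 * n + 1) M} {w : Fin (p + 1) → OneForm (2 * n + 1) M}

theorem ne_zero_of_sum_sq_eq_one {ι : Type*} [Fintype ι] {c : ι → ℝ} (hc : ∑ i, c i ^ 2 = 1) :
    c ≠ 0 := by
  rintro rfl
  simp at hc

theorem sum_single_smul {V : Type*} [AddCommGroup V] [Module ℝ V] {ι : Type*} [Fintype ι]
    [DecidableEq ι] (v : ι → V) (i : ι) : ∑ j, (Pi.single i 1 : ι → ℝ) j • v j = v i := by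
  rw [Finset.sum_eq_single i] <;> simp +contextual

theorem IsInvariantContactSphere.invariantForm (hw : IsInvariantContactSphere w)
    (i : Fin (p + 1)) : InvariantForm (w i) := by
  refine (hw _ ⟨Pi.single i 1, ?_, (sum_single_smul w i).symm⟩).2
  rw [Finset.sum_eq_single i] <;> simp +contextual

variable [IsManifold (𝓡 (2 * n)) ∞ B]

/-- After normalization, every non-trivial combination of the generators is a contact form, so its
vertical coefficient has no critical zero. -/
theorem IsInvariantContactSphere.isRegularSystem (hw : IsInvariantContactSphere w)
    (hpr : IsPrincipalCircleBundle (d := 2 * n) (e := 2 * n + 1) pr) (hα : IsConnectionForm α) :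
    IsRegularSystem (d := 2 * n) fun i => verticalCoeff pr hpr.surjective (w i) := by
  have hφ := fun i => contMDiff_verticalCoeff hpr (hw.invariantForm i)
  intro c hc b h0 h1
  obtain ⟨k, hk, hsum⟩ := exists_smul_sum_sq_eq_one hc
  obtain ⟨x, rfl⟩ := hpr.surjective b
  obtain ⟨hcon, hinv⟩ := hw _ ⟨k • c, hsum, rfl⟩
  obtain ⟨η, hη⟩ := hpr.exists_decomposes hα hinv
  have heq := funext (verticalCoeff_sum_smul hpr.surjective (k • c) w)
  have hne := hcon.differentialAt_ne_zero hpr.contMDiff_proj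
    (contMDiff_verticalCoeff hpr hinv) hη x (by
      rw [heq]
      simp only [Pi.smul_apply, smul_eq_mul, mul_assoc, ← Finset.mul_sum]
      rw [h0, mul_zero])
  rw [heq, differentialAt_sum_mul hφ] at hne
  refine hne ?_
  simp only [Pi.smul_apply, smul_assoc, ← Finset.smul_sum]
  rw [h1, smul_zero]

theorem IsInvariantContactSphere.singularSet_eq (hw : IsInvariantContactSphere w)
    (hpr : IsPrincipalCircleBundle (d := 2 * n) (e := 2 * n + 1) pr) (hα : IsConnectionForm α)
    {c : Fin (p + 1) → ℝ} (hc : ∑ i, c i ^ 2 = 1) :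
    singularSet (d := 2 * n) pr α (∑ i, c i • w i) =
      {b | ∑ i, c i * verticalCoeff pr hpr.surjective (w i) b = 0} := by
  rw [ContactSphere.singularSet_eq hpr hα (hw _ ⟨c, hc, rfl⟩).2]
  simp only [verticalCoeff_sum_smul]

/-- Combinations of norm one that are neither equal nor opposite have independent
coefficients. -/
theorem linearIndependent_of_sum_smul_ne {V : Type*} [AddCommGroup V] [Module ℝ V] {ι : Type*}
    [Fintype ι] {v : ι → V} {c c' : ι → ℝ} (hc : ∑ i, c i ^ 2 = 1) (hc' : ∑ i, c' i ^ 2 = 1)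
    (h1 : ∑ i, c i • v i ≠ ∑ i, c' i • v i) (h2 : ∑ i, c i • v i ≠ -∑ i, c' i • v i) :
    LinearIndependent ℝ ![c, c'] := by
  rw [LinearIndependent.pair_iff' (ne_zero_of_sum_sq_eq_one hc)]
  rintro k rfl
  have hk : k ^ 2 = 1 := by
    simpa only [Pi.smul_apply, smul_eq_mul, mul_pow, ← Finset.mul_sum, hc, mul_one] using hc'
  rcases eq_or_eq_neg_of_sq_eq_sq k 1 (by rw [hk, one_pow]) with rfl | rfl
  · exact h1 (by simp)
  · exact h2 (by simp)

end ContactSphereFamily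

end ContactSphere

end

theorem mainTheorem11 (n p : ℕ) {B M : Type*}
    [TopologicalSpace B] [ChartedSpace (EuclideanSpace ℝ (Fin (2 * n))) B]
    [IsManifold (𝓡 (2 * n)) ∞ B] [T2Space B] [CompactSpace B] [ConnectedSpace B]
    [TopologicalSpace M] [ChartedSpace (EuclideanSpace ℝ (Fin (2 * n + 1))) M]
    [IsManifold (𝓡 (2 * n + 1)) ∞ M] [T2Space M] [MulAction Circle M]
    (pr : M → B)
    (hpr : ContactSphere.IsPrincipalCircleBundle (d := 2 * n) (e := 2 * n + 1) pr)
    (α : ContactSphere.OneForm (2 * n + 1) M) (hα : ContactSphere.IsConnectionForm α)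
    (w : Fin (p + 1) → ContactSphere.OneForm (2 * n + 1) M)
    (hw : ContactSphere.IsInvariantContactSphere w) :
    -- the singular sets are submanifolds, of codimension 1
    (∀ θ ∈ ContactSphere.sphereFamily w,
      ContactSphere.IsSubmanifold (d := 2 * n) 1
        (ContactSphere.singularSet (d := 2 * n) pr α θ)) ∧
    -- every point of the base lies on the singular set of some element
    (1 ≤ p → ∀ b : B, ∃ θ ∈ ContactSphere.sphereFamily w,
      b ∈ ContactSphere.singularSet (d := 2 * n) pr α θ) ∧
    -- the singular sets of any two elements are isotopic
    (∀ θ₁ ∈ ContactSphere.sphereFamily w, ∀ θ₂ ∈ ContactSphere.sphereFamily w,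
      ContactSphere.AreIsotopic (d := 2 * n)
        (ContactSphere.singularSet (d := 2 * n) pr α θ₁)
        (ContactSphere.singularSet (d := 2 * n) pr α θ₂)) ∧
    -- the singular set of every element is non-empty
    (1 ≤ p → ∀ θ ∈ ContactSphere.sphereFamily w,
      (ContactSphere.singularSet (d := 2 * n) pr α θ).Nonempty) ∧
    -- the singular sets of two different, non-opposite elements intersect transversally
    (∀ θ₁ ∈ ContactSphere.sphereFamily w, ∀ θ₂ ∈ ContactSphere.sphereFamily w,
      θ₁ ≠ θ₂ → θ₁ ≠ -θ₂ →
      ContactSphere.IntersectTransversally (d := 2 * n)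
        (ContactSphere.singularSet (d := 2 * n) pr α θ₁)
        (ContactSphere.singularSet (d := 2 * n) pr α θ₂)) := by
  have hreg := hw.isRegularSystem hpr hα
  have hφ := fun i => ContactSphere.contMDiff_verticalCoeff hpr (hw.invariantForm i)
  have hmeet : 1 ≤ p → ∀ b : B, ∃ θ ∈ ContactSphere.sphereFamily w,
      b ∈ ContactSphere.singularSet (d := 2 * n) pr α θ := by
    intro hp b
    obtain ⟨c, hc, hc0⟩ := ContactSphere.exists_sum_sq_eq_one_sum_mul_eq_zero hp
      fun i => ContactSphere.verticalCoeff pr hpr.surjective (w i) b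
    refine ⟨_, ⟨c, hc, rfl⟩, ?_⟩
    rw [hw.singularSet_eq hpr hα hc]
    exact hc0
  have hiso : ∀ θ₁ ∈ ContactSphere.sphereFamily w, ∀ θ₂ ∈ ContactSphere.sphereFamily w,
      ContactSphere.AreIsotopic (d := 2 * n)
        (ContactSphere.singularSet (d := 2 * n) pr α θ₁)
        (ContactSphere.singularSet (d := 2 * n) pr α θ₂) := by
    rintro _ ⟨c, hc, rfl⟩ _ ⟨c', hc', rfl⟩
    rw [hw.singularSet_eq hpr hα hc, hw.singularSet_eq hpr hα hc']
    exact hreg.areIsotopic hφ (ContactSphere.ne_zero_of_sum_sq_eq_one hc)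
      (ContactSphere.ne_zero_of_sum_sq_eq_one hc')
  refine ⟨?_, hmeet, hiso, ?_, ?_⟩
  · rintro _ ⟨c, hc, rfl⟩
    rw [hw.singularSet_eq hpr hα hc]
    refine ContactSphere.isSubmanifold_zeroSet (ContactSphere.contMDiff_sum_mul hφ c) fun b hb => ?_
    rw [ContactSphere.differentialAt_sum_mul hφ]
    exact hreg c (ContactSphere.ne_zero_of_sum_sq_eq_one hc) b hb
  · intro hp θ hθ
    obtain ⟨b⟩ := (inferInstance : Nonempty B)
    obtain ⟨θ', hθ', hb⟩ := hmeet hp b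
    obtain ⟨F, -, -, hF⟩ := hiso θ' hθ' θ hθ
    rw [← hF]
    exact ⟨_, Set.mem_image_of_mem _ hb⟩
  · rintro _ ⟨c, hc, rfl⟩ _ ⟨c', hc', rfl⟩ h1 h2
    have hpen := hreg.isRegularPencil hφ
      (ContactSphere.linearIndependent_of_sum_smul_ne hc hc' h1 h2)
    rw [hw.singularSet_eq hpr hα hc, hw.singularSet_eq hpr hα hc']
    refine ContactSphere.intersectTransversally_zeroSets (ContactSphere.contMDiff_sum_mul hφ c)
      (ContactSphere.contMDiff_sum_mul hφ c') fun b hb hb' a a' h => hpen b a a'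
        ((congrArg₂ (fun u v => a * u + a' * v) hb hb').trans (by simp)) h
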